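/- Let $n\ge 2$ be an integer and $m=\lfloor \sqrt n/2\rfloor$. Let $I_n$ be the set of all pairs $(i,j)$ of positive integers such that either (a) $i,j\le n$ and not ($i\ge n-m+1$ and $j\ge 3$), or (b) $n+1\le i\le n+2n^4$ and $j\in\{1,2\}$, or (c) $i\in\{1,2\}$ and $n+1\le j\le n+25n^8$. The modified slanted grid graph $G=G_n$ has the vertices $v_1$, $v_2$ and $v_{i,j}$ for $(i,j)\in I_n$, and exactly the following edges: $v_1v_2$; $v_1v_{1,j}$ for all $j$; $v_2v_{i,1}$ for all $i$; $v_{i,j}v_{k,l}$ whenever $i\ne k$ and $j\ne l$; and $v_{i,j}v_{i+1,j}$ and $v_{i,j}v_{i,j+1}$, whenever both ends are vertices of $G$. A visibility embedding of $G$ is an injective map $f:V(G)\to\mathbb R^2$ such that distinct vertices $u,v$ are adjacent if and only if the closed segment $f(u)f(v)$ contains no point of $f(V(G))$ other than $f(u)$ and $f(v)$. A line of $f$ is a straight line containing at least two points of $f(V(G))$. If $u_1,\dots,u_s$ are the vertices whose points lie on the line, in their order along it, then the line is preserved in a visibility embedding $f'$ if the points $f'(u_1),\dots,f'(u_s)$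 lie in this order on one straight line that contains no other point of $f'(V(G))$. The $j$-th horizontal line is the sequence $v_1,v_{1,j},v_{2,j},\dots$ ($1\le j\le n+25n^8$), and the $i$-th vertical line is the sequence $v_2,v_{i,1},v_{i,2},\dots$ ($1\le i\le n+2n^4$), each running through all vertices of $G$ in that row or column. The long lines $L_1,L_2$ are the first and second vertical lines, and $L_3,L_4$ are the first and second horizontal lines. Then $G$ has a visibility embedding, unique up to the preservation of lines: for any two visibility embeddings $f,f'$ of $G$, every line of $f$ is preserved in $f'$. Moreover, in every visibility embedding of $G$, the points of each of $L_1,L_2,L_3,L_4$, and of every horizontal and every vertical line, lie on one straight line, in the listed order, and no other embedding point lies on that line. -/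

import Mathlib

/-- The Euclidean plane. -/
abbrev Plane : Type := EuclideanSpace ℝ (Fin 2)

/-- `f` is a visibility embedding of the graph `G`: the vertices are placed injectively in the
plane, and two distinct vertices are adjacent exactly when the closed segment joining their points
contains no other embedding point. -/
def IsVisibilityEmbedding {V : Type*} (G : SimpleGraph V) (f : V → Plane) : Prop :=
  Function.Injective f ∧
    ∀ u v : V, u ≠ v →
      (G.Adj u v ↔ Set.range f ∩ segment ℝ (f u) (f v) = {f u, f v})

/-- `L` lists, in the order in which they occur along some straight line `{p + t • d}` and without
omissions, all the vertices (at least two) whose points lie on that line. -/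
def IsLineSequence {V : Type*} (f : V → Plane) (L : List V) : Prop :=
  2 ≤ L.length ∧
    ∃ (p d : Plane) (t : V → ℝ), d ≠ 0 ∧
      (∀ v ∈ L, f v = p + t v • d) ∧
      L.Pairwise (fun u v => t u < t v) ∧
      ∀ v, v ∉ L → ∀ s : ℝ, f v ≠ p + s • d

/-- The line of an embedding whose sequence of points is `L` is preserved in the embedding `f'`:
the images of its points again lie on one line, in the same order, with no further point on it. -/
def IsPreservedIn {V : Type*} (L : List V) (f' : V → Plane) : Prop :=
  IsLineSequence f' L

/-- The width `⌊√n / 2⌋` of the deleted subgrid. -/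
def gapWidth (n : ℕ) : ℕ := Nat.sqrt n / 2

/-- The pairs `(i, j)` for which the modified slanted grid has a grid vertex in the `i`-th column
(counted from the right) and the `j`-th row (counted from the top): the `n × n` grid without its
bottom-left block of the last `gapWidth n` columns and the rows `3, …, n`, together with `2 n ^ 4`
new places in each of the rows `1, 2` and `25 n ^ 8` new places in each of the columns `1, 2`. -/
abbrev InGrid (n i j : ℕ) : Prop :=
  ((1 ≤ i ∧ i ≤ n) ∧ (1 ≤ j ∧ j ≤ n) ∧ ¬(n + 1 ≤ i + gapWidth n ∧ 3 ≤ j)) ∨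
  ((n + 1 ≤ i ∧ i ≤ n + 2 * n ^ 4) ∧ (1 ≤ j ∧ j ≤ 2)) ∨
  ((1 ≤ i ∧ i ≤ 2) ∧ (n + 1 ≤ j ∧ j ≤ n + 25 * n ^ 8))

/-- The vertices: two vertices of convergence `c₁`, `c₂` and the grid vertices. -/
inductive MSGGVertex (n : ℕ) : Type
  | c₁ : MSGGVertex n
  | c₂ : MSGGVertex n
  | grid (i j : ℕ) (h : InGrid n i j) : MSGGVertex n

/-- The edges of the modified slanted grid graph, each listed in at least one direction:
`c₁` sees the first vertex of every row and `c₂` the first vertex of every column, `c₁` sees `c₂`,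
grid vertices in different rows and different columns see each other, and so do consecutive
vertices of a row or of a column. -/
def msggRel (n : ℕ) : MSGGVertex n → MSGGVertex n → Prop
  | .c₁, .c₂ => True
  | .c₁, .grid i _ _ => i = 1
  | .c₂, .grid _ j _ => j = 1
  | .grid i j _, .grid k l _ =>
      (i ≠ k ∧ j ≠ l) ∨ (j = l ∧ k = i + 1) ∨ (i = k ∧ l = j + 1)
  | _, _ => False

/-- The modified slanted grid graph built from the `n × n` slanted grid graph. -/
def msgg (n : ℕ) : SimpleGraph (MSGGVertex n) := SimpleGraph.fromRel (msggRel n)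

/-- The `j`-th horizontal line (from the top): `c₁`, followed by the vertices of the `j`-th row. -/
def horizontalLine (n j : ℕ) : List (MSGGVertex n) :=
  .c₁ :: (List.range' 1 (n + 2 * n ^ 4)).filterMap
    (fun i => if h : InGrid n i j then some (.grid i j h) else none)

/-- The `i`-th vertical line (from the right): `c₂`, followed by the vertices of the `i`-th
column. -/
def verticalLine (n i : ℕ) : List (MSGGVertex n) :=
  .c₂ :: (List.range' 1 (n + 25 * n ^ 8)).filterMap
    (fun j => if h : InGrid n i j then some (.grid i j h) else none)

/-- The long lines `L₁`, `L₂` (rightmost and second-rightmost vertical lines) and `L₃`, `L₄`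
(topmost and second-topmost horizontal lines). -/
def longLines (n : ℕ) : List (List (MSGGVertex n)) :=
  [verticalLine n 1, verticalLine n 2, horizontalLine n 1, horizontalLine n 2]

/-! Uniqueness rests on two facts. A vertex that `c₁` does not see is hidden behind a neighbour of
`c₁`, that is, behind `c₂` or a vertex of the first column; and of the vertices behind a given one
on a ray, at most one is its neighbour. Suppose first that `c₂` hides nothing from `c₁`. Counting
then shows that the second vertex on the ray through each first-column vertex lies in the second
column (`exists_second`). As vertices in different rows and columns are adjacent, every later vertex
must lie behind the first vertex of its own row (`behind_row`), and in rows of length at least four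
the second vertex is forced too (`behind_second_of_long`).

The crux is `not_behind_convergence`: the supposition always holds. If it fails, its mirror image
holds by `not_behind_of_behind`, so the first two columns are straight; with the first column as an
axis, a vertex of the open quadrant closest to that axis would need a blocker that is closer still.
After that, `first_lt_first` shows that hiding is a monotone bijection between the first two
columns, hence matches rows (`behind_second`), which settles the short rows. Columns follow by the
symmetry `swap`.

Two non-adjacent vertices always share a horizontal or vertical line. Hence a line with three or
more points is one of these, and a two-point line cannot gain a point in another embedding
(`isPreservedIn_of_family`).

For existence, put `c₁`, `c₂` at the infinite points of the axes and the grid vertices at `(1/i,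
1/(j + √2))`, then change the projective chart so that all points are finite. Irrationality excludes
collinear triples on slanted lines (`eq_of_combination`). -/

section Behind

/-! ### Betweenness and visibility in a real vector space -/

variable {V E : Type*} [AddCommGroup E] [Module ℝ E] {f : V → E}

/-- The point of `w` lies strictly between those of `u` and `v`. -/
def Behind (f : V → E) (u w v : V) : Prop :=
  f w ≠ f u ∧ ∃ μ : ℝ, 1 < μ ∧ f v - f u = μ • (f w - f u)

theorem Behind.symm {u w v : V} (h : Behind f u w v) : Behind f v w u := by
  obtain ⟨hne, μ, hμ, h⟩ := h
  have hv : f v = f u + μ • (f w - f u) := by rw [← h]; abel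
  have h1 : μ - 1 ≠ 0 := by linarith
  refine ⟨fun h2 => ?_, μ / (μ - 1), ?_, ?_⟩
  · have h3 : (μ - 1) • (f w - f u) = 0 := by
      have : (μ - 1) • (f w - f u) = f v - f w := by rw [hv]; module
      rw [this, h2, sub_self]
    rcases smul_eq_zero.1 h3 with h4 | h4
    · exact h1 h4
    · exact hne (sub_eq_zero.1 h4)
  · rw [lt_div_iff₀ (by linarith)]; linarith
  · rw [hv]
    match_scalars <;> field_simp <;> ring

theorem Behind.ne_right {u w v : V} (h : Behind f u w v) : f w ≠ f v :=
  h.symm.1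

theorem Behind.ne {u w v : V} (h : Behind f u w v) : f v ≠ f u := by
  obtain ⟨hne, μ, hμ, h⟩ := h
  intro h0
  rw [h0, sub_self, eq_comm, smul_eq_zero] at h
  rcases h with h | h
  · linarith
  · exact hne (sub_eq_zero.1 h)

theorem Behind.trans {u x w v : V} (h : Behind f u x w) (h' : Behind f u w v) :
    Behind f u x v := by
  obtain ⟨hne, μ, hμ, h⟩ := h
  obtain ⟨-, ν, hν, h'⟩ := h'
  exact ⟨hne, ν * μ, by nlinarith, by rw [h', h, smul_smul]⟩

theorem Behind.of_between {u w x v : V} (h : Behind f u w v) (h' : Behind f w x v) :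
    Behind f u w x := by
  obtain ⟨hne, μ, hμ, h⟩ := h
  obtain ⟨-, ν, hν, h'⟩ := h'
  refine ⟨hne, 1 + (μ - 1) / ν, by have : 0 < (μ - 1) / ν := by apply div_pos <;> linarith
                                   linarith, ?_⟩
  have hν0 : ν ≠ 0 := by linarith
  have hx : f x = f w + ν⁻¹ • (f v - f w) := by
    rw [h', smul_smul, inv_mul_cancel₀ hν0]; module
  have hv : f v = f u + μ • (f w - f u) := by rw [← h]; abel
  rw [hx, hv]
  match_scalars <;> field_simp <;> ring

theorem Behind.between {u w v v' : V} (h : Behind f u w v) (h' : Behind f u v v') :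
    Behind f w v v' := by
  obtain ⟨hne, μ, hμ, h⟩ := h
  obtain ⟨-, ν, hν, h'⟩ := h'
  have hv : f v = f u + μ • (f w - f u) := by rw [← h]; abel
  have hv' : f v' = f u + (ν * μ) • (f w - f u) := by rw [mul_smul, ← h, ← h']; abel
  have h1 : μ - 1 ≠ 0 := by linarith
  refine ⟨fun h2 => ?_, (ν * μ - 1) / (μ - 1), ?_, ?_⟩
  · have h3 : (μ - 1) • (f w - f u) = 0 := by
      have : (μ - 1) • (f w - f u) = f v - f w := by rw [hv]; module
      rw [this, h2, sub_self]
    rcases smul_eq_zero.1 h3 with h4 | h4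
    · exact h1 h4
    · exact hne (sub_eq_zero.1 h4)
  · rw [lt_div_iff₀ (by linarith)]; nlinarith
  · rw [hv, hv']
    match_scalars <;> field_simp <;> ring

theorem behind_of_smul (hf : Function.Injective f) {u w x : V} (hw : w ≠ u) {c : ℝ}
    (h : f x - f u = c • (f w - f u)) :
    x = u ∨ x = w ∨ Behind f u w x ∨ Behind f u x w ∨ Behind f w u x := by
  have hne : f w ≠ f u := fun h => hw (hf h)
  rcases lt_trichotomy c 0 with hc | hc | hc
  · right; right; right; right
    refine ⟨hne.symm, 1 - c, by linarith, ?_⟩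
    have hx : f x = f u + c • (f w - f u) := by rw [← h]; abel
    rw [hx]; module
  · left
    rw [hc, zero_smul, sub_eq_zero] at h
    exact hf h
  right
  rcases lt_trichotomy c 1 with hc1 | hc1 | hc1
  · right; right; left
    refine ⟨fun h0 => ?_, c⁻¹, (one_lt_inv₀ hc).2 hc1, ?_⟩
    · rw [h0, sub_self, eq_comm, smul_eq_zero] at h
      rcases h with h | h
      · exact hc.ne' h
      · exact hne (sub_eq_zero.1 h)
    · rw [h, smul_smul, inv_mul_cancel₀ hc.ne', one_smul]
  · left
    rw [hc1, one_smul] at h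
    exact hf (sub_left_injective h)
  · right; left
    exact ⟨hne, c, hc1, h⟩

theorem Behind.total (hf : Function.Injective f) {u w v v' : V} (h : Behind f u w v)
    (h' : Behind f u w v') : v' = v ∨ Behind f u v v' ∨ Behind f u v' v := by
  have hvu := h.ne
  have hv'u := h'.ne
  obtain ⟨hne, μ, hμ, h⟩ := h
  obtain ⟨-, ν, hν, h'⟩ := h'
  have hμ0 : μ ≠ 0 := by linarith
  have hpos : 0 < ν / μ := div_pos (by linarith) (by linarith)
  have h2 : f v' - f u = (ν / μ) • (f v - f u) := by
    rw [h', h, smul_smul, div_mul_cancel₀ _ hμ0]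
  rcases lt_trichotomy (ν / μ) 1 with hc | hc | hc
  · right; right
    refine ⟨hv'u, (ν / μ)⁻¹, (one_lt_inv₀ hpos).2 hc, ?_⟩
    rw [h2, smul_smul, inv_mul_cancel₀ hpos.ne', one_smul]
  · left
    rw [hc, one_smul] at h2
    exact hf (sub_left_injective h2)
  · right; left
    exact ⟨hvu, _, hc, h2⟩

/-- Visibility embeddings of `G` in an arbitrary real vector space, in terms of `Behind`. -/
structure IsVisibility (G : SimpleGraph V) (f : V → E) : Prop where
  inj : Function.Injective f
  adj_iff : ∀ u v, u ≠ v → (G.Adj u v ↔ ∀ w, ¬ Behind f u w v)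

namespace IsVisibility

variable {G : SimpleGraph V}

theorem not_behind (hf : IsVisibility G f) {u w v : V} (h : G.Adj u v) : ¬ Behind f u w v :=
  (hf.adj_iff u v h.ne).1 h w

theorem not_adj (hf : IsVisibility G f) {u w v : V} (h : Behind f u w v) : ¬ G.Adj u v :=
  fun h' => hf.not_behind h' h

/-- A point that is not seen from `u` is hidden behind one that is. -/
theorem exists_adj_behind [Finite V] (hf : IsVisibility G f) {u v : V} (huv : u ≠ v)
    (h : ¬ G.Adj u v) : ∃ w, G.Adj u w ∧ Behind f u w v := by
  rw [hf.adj_iff u v huv] at h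
  push Not at h
  by_contra! hcon
  have key : ∀ x, Behind f u x v → ∃ y, Behind f u y x ∧ Behind f u y v := by
    intro x hx
    have hux : u ≠ x := fun h => hx.1 (by rw [h])
    have h1 : ¬ G.Adj u x := fun h => hcon x h hx
    rw [hf.adj_iff u x hux] at h1
    push Not at h1
    obtain ⟨y, hy⟩ := h1
    exact ⟨y, hy, hy.trans hx⟩
  have hirr : ∀ x, ¬ Behind f u x x := fun x hx => hx.ne_right rfl
  -- Betweenness from `u` is a strict order on a finite type, so there is a blocker nearest to `u`,
  -- contradicting `key`.
  let r : V → V → Prop := fun y x => Behind f u y x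
  have : IsTrans V r := ⟨fun _ _ _ h h' => Behind.trans h h'⟩
  have : Std.Irrefl r := ⟨hirr⟩
  have hwf : WellFounded r := Finite.wellFounded_of_trans_of_irrefl r
  obtain ⟨w, hw⟩ := h
  obtain ⟨m, hm, hmin⟩ := hwf.has_min {x | Behind f u x v} ⟨w, hw⟩
  obtain ⟨y, hy1, hy2⟩ := key m hm
  exact hmin y hy2 hy1

/-- At most one of the points behind `w` is seen from `w`. -/
theorem eq_of_behind_of_adj (hf : IsVisibility G f) {u w x x' : V} (h : Behind f u w x)
    (h' : Behind f u w x') (ha : G.Adj w x) (ha' : G.Adj w x') : x = x' := by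
  rcases h.total hf.inj h' with h1 | h1 | h1
  · exact h1.symm
  · exact (hf.not_behind ha' (h.between h1)).elim
  · exact (hf.not_behind ha (h'.between h1)).elim

/-- Both hiding vertices lie on the ray from `u` to `v`, so the nearer would hide the farther from
`u`. -/
theorem eq_of_adj_of_behind (hf : IsVisibility G f) {u w w' v : V} (h : Behind f u w v)
    (h' : Behind f u w' v) (ha : G.Adj u w) (ha' : G.Adj u w') : w = w' := by
  obtain ⟨hne, μ, hμ, h⟩ := h
  obtain ⟨hne', ν, hν, h'⟩ := h'
  have hν0 : ν ≠ 0 := by linarith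
  have h2 : f w' - f u = (μ / ν) • (f w - f u) := by
    rw [div_eq_inv_mul, mul_smul, ← h, h', smul_smul, inv_mul_cancel₀ hν0, one_smul]
  have hpos : 0 < μ / ν := div_pos (by linarith) (by linarith)
  rcases behind_of_smul hf.inj ha.ne' h2 with h3 | h3 | h3 | h3 | h3
  · exact (ha'.ne' h3).elim
  · exact h3.symm
  · exact (hf.not_behind ha' h3).elim
  · exact (hf.not_behind ha h3).elim
  -- `u` cannot separate `w` from `w'`: the ratio `μ / ν` is positive.
  · obtain ⟨hu, κ, hκ, h3⟩ := h3
    exfalso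
    have h4 : f w' - f w = (1 - κ) • (f w - f u) + (f u - f w) := by
      rw [h3]; module
    have h5 : (μ / ν + (κ - 1)) • (f w - f u) = 0 := by
      have : f w' - f u = (1 - κ) • (f w - f u) := by
        have : f w' - f u = (f w' - f w) + (f w - f u) := by abel
        rw [this, h4]; module
      rw [add_smul, ← h2, this]; module
    rcases smul_eq_zero.1 h5 with h6 | h6
    · linarith
    · exact hne (sub_eq_zero.1 h6)

end IsVisibility

end Behind

/-! ### Slanted grids in the shape of a Young diagram -/

/-- `G` consists of two vertices of convergence and a grid in the shape of a Young diagram `S` whose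
first two rows, and first two columns, are of equal lengths at least four. -/
structure IsSlantedGrid {V : Type*} (G : SimpleGraph V) (S : ℕ → ℕ → Prop) (c₁ c₂ : V)
    (g : ℕ → ℕ → V) : Prop where
  pos : ∀ {i j}, S i j → 1 ≤ i ∧ 1 ≤ j
  left : ∀ {i j k}, S i j → 1 ≤ k → k ≤ i → S k j
  up : ∀ {i j k}, S i j → 1 ≤ k → k ≤ j → S i k
  two_left : ∀ {j}, S 1 j → S 2 j
  two_up : ∀ {i}, S i 1 → S i 2
  four_left : S 4 1
  four_up : S 1 4
  cases : ∀ v, v = c₁ ∨ v = c₂ ∨ ∃ i j, S i j ∧ v = g i j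
  inj : ∀ {i j k l}, S i j → S k l → g i j = g k l → i = k ∧ j = l
  ne₁ : ∀ {i j}, S i j → g i j ≠ c₁
  ne₂ : ∀ {i j}, S i j → g i j ≠ c₂
  adj : G.Adj c₁ c₂
  adj₁ : ∀ {i j}, S i j → (G.Adj c₁ (g i j) ↔ i = 1)
  adj₂ : ∀ {i j}, S i j → (G.Adj c₂ (g i j) ↔ j = 1)
  adj_iff : ∀ {i j k l}, S i j → S k l → (G.Adj (g i j) (g k l) ↔
    (i ≠ k ∧ j ≠ l) ∨ (j = l ∧ (k = i + 1 ∨ i = k + 1)) ∨ (i = k ∧ (l = j + 1 ∨ j = l + 1)))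

namespace IsSlantedGrid

variable {V E : Type*} [AddCommGroup E] [Module ℝ E] {f : V → E} {G : SimpleGraph V}
  {S : ℕ → ℕ → Prop} {c₁ c₂ : V} {g : ℕ → ℕ → V}

/-- Through this reflection, each result on rows seen from `c₁` also serves for columns seen from
`c₂`. -/
theorem swap (h : IsSlantedGrid G S c₁ c₂ g) :
    IsSlantedGrid G (fun i j => S j i) c₂ c₁ (fun i j => g j i) where
  pos hs := (h.pos hs).symm
  left hs := h.up hs
  up hs := h.left hs
  two_left hs := h.two_up hs
  two_up hs := h.two_left hs
  four_left := h.four_up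
  four_up := h.four_left
  cases v := by
    rcases h.cases v with h | h | ⟨i, j, hs, h⟩
    · exact Or.inr (Or.inl h)
    · exact Or.inl h
    · exact Or.inr (Or.inr ⟨j, i, hs, h⟩)
  inj hs hs' he := (h.inj hs hs' he).symm
  ne₁ hs := h.ne₂ hs
  ne₂ hs := h.ne₁ hs
  adj := h.adj.symm
  adj₁ hs := h.adj₂ hs
  adj₂ hs := h.adj₁ hs
  adj_iff hs hs' := by rw [h.adj_iff hs hs']; tauto

theorem first (h : IsSlantedGrid G S c₁ c₂ g) {i j : ℕ} (hs : S i j) : S 1 j :=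
  h.left hs le_rfl (h.pos hs).1

/-- Every vertex that `c₁` does not see is hidden behind `c₂` or the first vertex of a row. -/
theorem behind_first [Finite V] (h : IsSlantedGrid G S c₁ c₂ g) (hf : IsVisibility G f) {v : V}
    (hv : c₁ ≠ v) (ha : ¬ G.Adj c₁ v) :
    Behind f c₁ c₂ v ∨ ∃ j, S 1 j ∧ Behind f c₁ (g 1 j) v := by
  obtain ⟨w, hw, hb⟩ := hf.exists_adj_behind hv ha
  rcases h.cases w with rfl | rfl | ⟨i, j, hs, rfl⟩
  · exact (hw.ne rfl).elim
  · exact Or.inl hb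
  · obtain rfl := (h.adj₁ hs).1 hw
    exact Or.inr ⟨j, hs, hb⟩

/-! ### Rows, provided that `c₂` hides nothing from `c₁` -/

section Free

variable [Finite V] (h : IsSlantedGrid G S c₁ c₂ g) (hf : IsVisibility G f)
  (hX : ∀ v, ¬ Behind f c₁ c₂ v)

include h hf hX

theorem exists_first {i j : ℕ} (hs : S i j) (hi : 2 ≤ i) :
    ∃ k, S 1 k ∧ Behind f c₁ (g 1 k) (g i j) := by
  have hna : ¬ G.Adj c₁ (g i j) := by rw [h.adj₁ hs]; omega
  rcases h.behind_first hf (h.ne₁ hs).symm hna with h1 | h1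
  · exact (hX _ h1).elim
  · exact h1

/-- The second vertex on the ray from `c₁` through a vertex of the first column belongs to the
second column. -/
theorem exists_second {j : ℕ} (hs : S 1 j) : ∃ k, S 1 k ∧ Behind f c₁ (g 1 j) (g 2 k) := by
  have hex : ∀ k : {k // S 1 k}, ∃ j : {j // S 1 j}, Behind f c₁ (g 1 j) (g 2 k) := by
    rintro ⟨k, hk⟩
    obtain ⟨j, hj, hb⟩ := h.exists_first hf hX (h.two_left hk) le_rfl
    exact ⟨⟨j, hj⟩, hb⟩
  choose σ hσ using hex
  have hfin : Finite {k // S 1 k} := by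
    refine Finite.of_injective (fun k : {k // S 1 k} => g 1 k) ?_
    rintro ⟨a, ha⟩ ⟨b, hb⟩ hab
    exact Subtype.ext (h.inj ha hb hab).2
  have hadj : ∀ {a b}, S 1 a → S 1 b → G.Adj (g 1 a) (g 2 b) := by
    intro a b ha hb
    rw [h.adj_iff ha (h.two_left hb)]
    omega
  -- A first-column vertex is adjacent to the whole second column, so it hides at most one of its
  -- vertices; the injective self-map `σ` of a finite set is then onto.
  have hinj : Function.Injective σ := by
    intro a b hab
    have h1 := hσ a
    have h2 := hσ b
    rw [← hab] at h2
    have h3 := hf.eq_of_behind_of_adj h1 h2 (hadj (σ a).2 a.2) (hadj (σ a).2 b.2)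
    exact Subtype.ext (h.inj (h.two_left a.2) (h.two_left b.2) h3).2
  obtain ⟨k, hk⟩ := (Finite.injective_iff_surjective.1 hinj) ⟨j, hs⟩
  refine ⟨k, k.2, ?_⟩
  have := hσ k
  rwa [hk] at this

theorem eq_second_of_adj {j : ℕ} (hs : S 1 j) {v : V} (hb : Behind f c₁ (g 1 j) v)
    (ha : G.Adj (g 1 j) v) : ∃ k, S 1 k ∧ v = g 2 k := by
  obtain ⟨k, hk, hbk⟩ := h.exists_second hf hX hs
  refine ⟨k, hk, hf.eq_of_behind_of_adj hb hbk ha ?_⟩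
  rw [h.adj_iff hs (h.two_left hk)]
  omega

/-- A hiding vertex from another row would be adjacent to `g i j`, making `g i j` the second vertex
on its ray; but that one lies in the second column. -/
theorem behind_row {i j : ℕ} (hs : S i j) (hi : 3 ≤ i) : Behind f c₁ (g 1 j) (g i j) := by
  obtain ⟨k, hk, hb⟩ := h.exists_first hf hX hs (by omega)
  by_cases ha : G.Adj (g 1 k) (g i j)
  · obtain ⟨l, hl, he⟩ := h.eq_second_of_adj hf hX hk hb ha
    have := (h.inj hs (h.two_left hl) he).1
    omega
  · rw [h.adj_iff hk hs] at ha
    have : k = j := by omega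
    rwa [this] at hb

/-- If the second vertex on the ray came from another row, it would see both `g 3 j` and `g 4 j`
behind it. This is where length four is needed. -/
theorem behind_second_of_long {j : ℕ} (hs : S 4 j) : Behind f c₁ (g 1 j) (g 2 j) := by
  have hs1 := h.first hs
  have hs3 : S 3 j := h.left hs (by omega) (by omega)
  obtain ⟨k, hk, hb⟩ := h.exists_second hf hX hs1
  have hk2 := h.two_left hk
  by_cases hkj : k = j
  · rwa [hkj] at hb
  exfalso
  have key : ∀ {i}, S i j → 3 ≤ i → Behind f c₁ (g 2 k) (g i j) := by
    intro i hi h3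
    have hbi := h.behind_row hf hX hi h3
    rcases hb.total hf.inj hbi with h1 | h1 | h1
    · have := (h.inj hi hk2 h1).1
      omega
    · exact h1
    · refine (hf.not_adj (hbi.between h1) ?_).elim
      rw [h.adj_iff hs1 hk2]
      omega
  have := hf.eq_of_behind_of_adj (key hs3 le_rfl) (key hs (by omega))
    ((h.adj_iff hk2 hs3).2 (by omega)) ((h.adj_iff hk2 hs).2 (by omega))
  have := (h.inj hs3 hs this).1
  omega

omit [Finite V] hX in
/-- Vertices of a row behind its first vertex follow each other in the listed order. -/
theorem row_ordered {j : ℕ} (hb : ∀ i, S i j → 2 ≤ i → Behind f c₁ (g 1 j) (g i j)) {i : ℕ}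
    (hi : 1 ≤ i) : ∀ {k}, S k j → i < k → Behind f c₁ (g i j) (g k j) := by
  induction i, hi using Nat.le_induction with
  | base => exact fun hk h1 => hb _ hk (by omega)
  | succ i hi ih =>
    intro k hk hik
    have hi1 : S (i + 1) j := h.left hk (by omega) (by omega)
    have hi0 : S i j := h.left hk (by omega) (by omega)
    have h1 := ih hi1 (by omega)
    rcases h1.total hf.inj (ih hk (by omega)) with h2 | h2 | h2
    · have := (h.inj hk hi1 h2).1
      omega
    · exact h2
    -- Otherwise `g k j` would separate the consecutive vertices `g i j` and `g (i + 1) j`.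
    · refine (hf.not_adj ((ih hk (by omega)).between h2) ?_).elim
      rw [h.adj_iff hi0 hi1]
      omega

theorem long_row_ordered {j : ℕ} (hs : S 4 j) {i k : ℕ} (hi : 1 ≤ i) (hk : S k j) (hik : i < k) :
    Behind f c₁ (g i j) (g k j) := by
  refine h.row_ordered hf (fun l hl h2 => ?_) hi hk hik
  rcases h2.eq_or_lt with rfl | h3
  · exact h.behind_second_of_long hf hX hs
  · exact h.behind_row hf hX hl h3

end Free

end IsSlantedGrid

/-! ### Neither vertex of convergence hides anything from the other -/

theorem exists_linearMap_eq_zero_eq_one {E : Type*} [AddCommGroup E] [Module ℝ E] {e d : E}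
    (h : ∀ c : ℝ, d ≠ c • e) : ∃ φ : E →ₗ[ℝ] ℝ, φ e = 0 ∧ φ d = 1 := by
  have hd : d ∉ Submodule.span ℝ {e} := by
    rw [Submodule.mem_span_singleton]
    rintro ⟨c, hc⟩
    exact h c hc.symm
  obtain ⟨φ, hφ, hle⟩ := Submodule.exists_le_ker_of_notMem hd
  refine ⟨(φ d)⁻¹ • φ, ?_, ?_⟩
  · have : φ e = 0 := hle (Submodule.mem_span_singleton_self e)
    simp [this]
  · simp [inv_mul_cancel₀ hφ]

section

variable {V E : Type*} [AddCommGroup E] [Module ℝ E] {f : V → E}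

theorem Behind.glue {a b x y : V} (h : Behind f a b x) (h' : Behind f b a y) :
    Behind f y a x := by
  obtain ⟨hne, μ, hμ, h⟩ := h
  obtain ⟨-, ν, hν, h'⟩ := h'
  have hx : f x = f a + μ • (f b - f a) := by rw [← h]; abel
  have hy : f y = f b + ν • (f a - f b) := by rw [← h']; abel
  have h1 : ν - 1 ≠ 0 := by linarith
  refine ⟨fun h2 => ?_, (μ - 1 + ν) / (ν - 1), ?_, ?_⟩
  · have h3 : (ν - 1) • (f b - f a) = 0 := by
      have : (ν - 1) • (f b - f a) = f a - f y := by rw [hy]; module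
      rw [this, h2, sub_self]
    rcases smul_eq_zero.1 h3 with h4 | h4
    · exact h1 h4
    · exact hne (sub_eq_zero.1 h4)
  · rw [lt_div_iff₀ (by linarith)]; linarith
  · rw [hx, hy]
    match_scalars <;> field_simp <;> ring

namespace IsSlantedGrid

variable {G : SimpleGraph V} {S : ℕ → ℕ → Prop} {c₁ c₂ : V} {g : ℕ → ℕ → V} [Finite V]

/-- The vertex next beyond `c₂` is a neighbour of `c₂`, so it heads a column; not the first column,
whose head is seen from `c₁`. -/
theorem exists_behind_first_row (h : IsSlantedGrid G S c₁ c₂ g) (hf : IsVisibility G f) {v : V}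
    (hv : Behind f c₁ c₂ v) : ∃ i, 2 ≤ i ∧ S i 1 ∧ Behind f c₁ c₂ (g i 1) := by
  obtain ⟨u, hu, hb⟩ : ∃ u, G.Adj c₂ u ∧ Behind f c₁ c₂ u := by
    by_cases ha : G.Adj c₂ v
    · exact ⟨v, ha, hv⟩
    · have hne : c₂ ≠ v := by
        rintro rfl
        exact hf.not_adj hv h.adj
      obtain ⟨u, hu, hb⟩ := hf.exists_adj_behind hne ha
      exact ⟨u, hu, hv.of_between hb⟩
  rcases h.cases u with rfl | rfl | ⟨i, j, hs, rfl⟩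
  · exact (hb.ne rfl).elim
  · exact (hu.ne rfl).elim
  · obtain rfl := (h.adj₂ hs).1 hu
    refine ⟨i, ?_, hs, hb⟩
    have h1 : i ≠ 1 := fun h1 => hf.not_adj hb ((h.adj₁ hs).2 h1)
    have := (h.pos hs).1
    omega

/-- Otherwise the head of a column and the head of a row, neither of them `g 1 1`, would be adjacent
yet separated by `c₁` on the line `c₁c₂`. -/
theorem not_behind_of_behind (h : IsSlantedGrid G S c₁ c₂ g) (hf : IsVisibility G f) {v w : V}
    (hv : Behind f c₁ c₂ v) : ¬ Behind f c₂ c₁ w := by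
  intro hw
  obtain ⟨i, hi, hsi, hbi⟩ := h.exists_behind_first_row hf hv
  obtain ⟨j, hj, hsj, hbj⟩ := h.swap.exists_behind_first_row hf hw
  refine hf.not_adj (hbi.glue hbj) ?_
  rw [h.adj_iff hsj hsi]
  omega

theorem not_behind_convergence (h : IsSlantedGrid G S c₁ c₂ g) (hf : IsVisibility G f) {v : V} :
    ¬ Behind f c₁ c₂ v := by
  intro hv
  have hY : ∀ w, ¬ Behind f c₂ c₁ w := fun w => h.not_behind_of_behind hf hv
  have hs41 := h.four_left
  have hs11 : S 1 1 := h.first hs41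
  have hs31 : S 3 1 := h.left hs41 (by omega) (by omega)
  have hs21 : S 2 1 := h.left hs41 (by omega) (by omega)
  have col1 : ∀ {a b}, 1 ≤ a → S 1 b → a < b → Behind f c₂ (g 1 a) (g 1 b) :=
    fun ha hb hab => h.swap.long_row_ordered hf hY h.four_up ha hb hab
  have col2 : ∀ {a b}, 1 ≤ a → S 2 b → a < b → Behind f c₂ (g 2 a) (g 2 b) :=
    fun ha hb hab => h.swap.long_row_ordered hf hY (h.two_left h.four_up) ha hb hab
  have hind : ∀ c : ℝ, f (g 1 1) - f c₂ ≠ c • (f c₁ - f c₂) := by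
    intro c hc
    rcases behind_of_smul hf.inj h.adj.ne hc with h1 | h1 | h1 | h1 | h1
    · exact h.ne₂ hs11 h1
    · exact h.ne₁ hs11 h1
    · exact hY _ h1
    · exact hf.not_adj h1 h.adj.symm
    · exact hf.not_adj h1 ((h.adj₁ hs11).2 rfl)
  have hind' : ∀ c : ℝ, f c₁ - f c₂ ≠ c • (f (g 1 1) - f c₂) := by
    intro c hc
    rcases eq_or_ne c 0 with h0 | h0
    · rw [h0, zero_smul, sub_eq_zero] at hc
      exact h.adj.ne (hf.inj hc)
    · apply hind c⁻¹
      rw [hc, smul_smul, inv_mul_cancel₀ h0, one_smul]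
  -- Linear coordinates with `c₂` at the origin, `c₁` at `(-1, 0)` and `g 1 1` at `(0, 1)`.
  obtain ⟨ψ, hψA, hψD⟩ := exists_linearMap_eq_zero_eq_one hind
  obtain ⟨φ, hφD, hφA⟩ := exists_linearMap_eq_zero_eq_one hind'
  set x : V → ℝ := fun v => - φ (f v - f c₂) with hx
  set y : V → ℝ := fun v => ψ (f v - f c₂) with hy
  have hxB : ∀ {u w v}, ∀ {μ : ℝ}, f v - f u = μ • (f w - f u) → x v = x u + μ * (x w - x u) := by
    intro u w v μ he
    have h1 : f v - f c₂ = (f u - f c₂) + μ • ((f w - f c₂) - (f u - f c₂)) := by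
      have : f v - f c₂ = (f v - f u) + (f u - f c₂) := by abel
      rw [this, he]; module
    simp only [hx]
    rw [h1]
    simp only [map_add, map_smul, map_sub, smul_eq_mul]
    ring
  have hyB : ∀ {u w v}, ∀ {μ : ℝ}, f v - f u = μ • (f w - f u) → y v = y u + μ * (y w - y u) := by
    intro u w v μ he
    have h1 : f v - f c₂ = (f u - f c₂) + μ • ((f w - f c₂) - (f u - f c₂)) := by
      have : f v - f c₂ = (f v - f u) + (f u - f c₂) := by abel
      rw [this, he]; module
    simp only [hy]
    rw [h1]
    simp only [map_add, map_smul, map_sub, smul_eq_mul]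
  have hx1 : x c₁ = -1 := by simp only [hx, hφA]
  have hx2 : x c₂ = 0 := by simp [hx]
  have hy1 : y c₁ = 0 := hψA
  have hy2 : y c₂ = 0 := by simp [hy]
  have hx11 : x (g 1 1) = 0 := by simp only [hx, hφD, neg_zero]
  have hy11 : y (g 1 1) = 1 := hψD
  have hcol : ∀ {j}, S 1 j → x (g 1 j) = 0 ∧ 1 ≤ y (g 1 j) := by
    intro j hj
    rcases (h.pos hj).2.eq_or_lt with rfl | h1
    · exact ⟨hx11, hy11.ge⟩
    · obtain ⟨-, μ, hμ, hb⟩ := col1 le_rfl hj h1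
      rw [hxB hb, hyB hb, hx11, hy11, hx2, hy2]
      constructor <;> linarith
  have hback : ∀ {v}, Behind f c₁ c₂ v → 0 < x v ∧ y v = 0 := by
    rintro v ⟨-, μ, hμ, hb⟩
    rw [hxB hb, hyB hb, hx1, hx2, hy1, hy2]
    constructor <;> linarith
  -- Outside the first column, a vertex is hidden from `(-1, 0)` by the origin or by a point `(0,
  -- y)` with `y ≥ 1`.
  have hcase : ∀ v, v = c₁ ∨ v = c₂ ∨ (∃ j, S 1 j ∧ v = g 1 j) ∨ Behind f c₁ c₂ v ∨
      (0 < x v ∧ 1 < y v) := by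
    intro v
    rcases h.cases v with h1 | h1 | ⟨i, j, hs, rfl⟩
    · exact Or.inl h1
    · exact Or.inr (Or.inl h1)
    by_cases hi : i = 1
    · subst hi
      exact Or.inr (Or.inr (Or.inl ⟨j, hs, rfl⟩))
    · rcases h.behind_first hf (h.ne₁ hs).symm (by rwa [h.adj₁ hs]) with h1 | ⟨k, hk, h1⟩
      · exact Or.inr (Or.inr (Or.inr (Or.inl h1)))
      · obtain ⟨-, μ, hμ, hb⟩ := h1
        obtain ⟨h2, h3⟩ := hcol hk
        refine Or.inr (Or.inr (Or.inr (Or.inr ?_)))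
        rw [hxB hb, hyB hb, hx1, h2, hy1]
        constructor <;> nlinarith
  -- A blocker between `(0, 1)` and a point of the positive `x`-axis would have `x > 0` and `0 < y <
  -- 1`, where no vertex lies.
  have hthree : ∀ {i}, S i 1 → 3 ≤ i → ¬ Behind f c₁ c₂ (g i 1) := by
    intro i hi h3 hb
    have hna : ¬ G.Adj (g 1 1) (g i 1) := by rw [h.adj_iff hs11 hi]; omega
    have hne : g 1 1 ≠ g i 1 := fun he => by have := (h.inj hs11 hi he).1; omega
    rw [hf.adj_iff _ _ hne] at hna
    push Not at hna
    obtain ⟨q, -, μ, hμ, hq⟩ := hna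
    have hqx := hxB hq
    have hqy := hyB hq
    obtain ⟨hix, hiy⟩ := hback hb
    rw [hx11] at hqx
    rw [hy11, hiy] at hqy
    have hxq : 0 < x q := by
      by_contra! hcon
      nlinarith
    have hyq : 0 < y q ∧ y q < 1 := by constructor <;> by_contra! hcon <;> nlinarith
    rcases hcase q with rfl | rfl | ⟨j, hj, rfl⟩ | h1 | h1
    · linarith
    · linarith
    · linarith [(hcol hj).1]
    · linarith [(hback h1).2]
    · linarith
  -- By `hthree` the column head behind `c₂` is `g 2 1`, so the straight second column runs along
  -- the `x`-axis.
  have hcol2 : ∀ {j}, S 2 j → y (g 2 j) = 0 := by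
    have h21 : y (g 2 1) = 0 := by
      obtain ⟨i, hi, hsi, hbi⟩ := h.exists_behind_first_row hf hv
      have : i = 2 := by
        by_contra hne
        exact hthree hsi (by omega) hbi
      subst this
      exact (hback hbi).2
    intro j hj
    rcases (h.pos hj).2.eq_or_lt with rfl | h1
    · exact h21
    · obtain ⟨-, μ, hμ, hb⟩ := col2 le_rfl hj h1
      rw [hyB hb, hy2, h21]
      ring
  have hK : (g 3 1) ∈ {v | 0 < x v ∧ 0 < y v} := by
    rcases hcase (g 3 1) with h1 | h1 | ⟨j, hj, h1⟩ | h1 | h1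
    · exact (h.ne₁ hs31 h1).elim
    · exact (h.ne₂ hs31 h1).elim
    · have := (h.inj hs31 hj h1).1
      omega
    · exact (hthree hs31 le_rfl h1).elim
    · exact ⟨h1.1, by linarith⟩
  -- The vertex of the open quadrant nearest to the first column belongs to a column from the third
  -- on, so it is not seen from the first vertex of its row; the blocker is in the quadrant with
  -- smaller `x`.
  obtain ⟨v, ⟨hvx, hvy⟩, hmin⟩ :=
    Set.exists_min_image {v | 0 < x v ∧ 0 < y v} x (Set.toFinite _) ⟨_, hK⟩
  rcases h.cases v with rfl | rfl | ⟨a, b, hs, rfl⟩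
  · linarith
  · linarith
  have hs1 := h.first hs
  have ha1 : a ≠ 1 := by
    rintro rfl
    linarith [(hcol hs).1]
  have ha2 : a ≠ 2 := by
    rintro rfl
    linarith [hcol2 hs]
  have := (h.pos hs).1
  have hna : ¬ G.Adj (g 1 b) (g a b) := by rw [h.adj_iff hs1 hs]; omega
  have hne : g 1 b ≠ g a b := fun he => ha1 (h.inj hs1 hs he).1.symm
  rw [hf.adj_iff _ _ hne] at hna
  push Not at hna
  obtain ⟨q, -, μ, hμ, hq⟩ := hna
  obtain ⟨hbx, hby⟩ := hcol hs1
  have hqx := hxB hq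
  have hqy := hyB hq
  rw [hbx] at hqx
  have hxq : 0 < x q := by
    by_contra! hcon
    nlinarith
  have hyq : 0 < y q := by
    by_contra! hcon
    nlinarith
  have := hmin q ⟨hxq, hyq⟩
  nlinarith

/-! ### All rows are straight and contain no foreign vertices -/

/-- The order of two vertices of the second column is that of the vertices of the first column
that hide them from `c₁`. -/
theorem first_lt_first (h : IsSlantedGrid G S c₁ c₂ g) (hf : IsVisibility G f) {a b k l : ℕ}
    (ha : S 1 a) (hb : S 1 b) (hk : S 1 k) (hl : S 1 l) (hak : Behind f c₁ (g 1 a) (g 2 k))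
    (hbl : Behind f c₁ (g 1 b) (g 2 l)) (hkl : k < l) : a < b := by
  have hX : ∀ v, ¬ Behind f c₁ c₂ v := fun v => h.not_behind_convergence hf
  have hY : ∀ v, ¬ Behind f c₂ c₁ v := fun v => h.swap.not_behind_convergence hf
  have hk2 := h.two_left hk
  have hl2 := h.two_left hl
  by_contra! hba
  rcases hba.eq_or_lt with rfl | hba
  · have := hf.eq_of_behind_of_adj hak hbl ((h.adj_iff hb hk2).2 (by omega))
      ((h.adj_iff hb hl2).2 (by omega))
    have := (h.inj hk2 hl2 this).2
    omega
  have h1 : Behind f c₂ (g 1 b) (g 1 a) :=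
    h.swap.long_row_ordered hf hY h.four_up (h.pos hb).2 ha hba
  have h2 : Behind f c₂ (g 2 k) (g 2 l) :=
    h.swap.long_row_ordered hf hY (h.two_left h.four_up) (h.pos hk).2 hl2 hkl
  obtain ⟨-, μ, hμ, h1⟩ := h1
  obtain ⟨-, ν, hν, h2⟩ := h2
  obtain ⟨-, κ, hκ, hak⟩ := hak
  obtain ⟨-, τ, hτ, hbl⟩ := hbl
  -- Eliminating `g 1 a`, `g 2 k` and `g 2 l` leaves a linear relation between the vectors from `c₂`
  -- to `c₁` and to `g 1 b`.
  have key : (ν * (κ - 1) - (τ - 1)) • (f c₁ - f c₂) =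
      (ν * κ * μ - τ) • (f (g 1 b) - f c₂) := by
    have e1 : f (g 1 a) = f c₂ + μ • (f (g 1 b) - f c₂) := by rw [← h1]; abel
    have e2 : f (g 2 k) = f c₁ + κ • (f (g 1 a) - f c₁) := by rw [← hak]; abel
    have e3 : f (g 2 l) = f c₁ + τ • (f (g 1 b) - f c₁) := by rw [← hbl]; abel
    have e4 : f (g 2 l) = f c₂ + ν • (f (g 2 k) - f c₂) := by rw [← h2]; abel
    rw [e3, e2, e1] at e4
    rw [← sub_eq_zero] at e4 ⊢
    rw [← e4]
    module
  have hne1 : f c₁ - f c₂ ≠ 0 := fun h0 => h.adj.ne (hf.inj (sub_eq_zero.1 h0))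
  by_cases hc : ν * (κ - 1) - (τ - 1) = 0
  · rw [hc, zero_smul, eq_comm, smul_eq_zero] at key
    rcases key with h3 | h3
    -- If both coefficients vanish, then `τ = νκ - ν + 1 < νκ < νκμ = τ`.
    · nlinarith [mul_pos (mul_pos (show (0:ℝ) < ν by linarith) (show (0:ℝ) < κ by linarith))
        (show (0:ℝ) < μ - 1 by linarith)]
    · exact h.ne₂ hb (hf.inj (sub_eq_zero.1 h3))
  -- Otherwise `c₁`, `c₂`, `g 1 b` are collinear, and no order of the three is possible.
  · have h3 : f c₁ - f c₂ = ((ν * (κ - 1) - (τ - 1))⁻¹ * (ν * κ * μ - τ)) •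
        (f (g 1 b) - f c₂) := by
      rw [mul_smul, ← key, smul_smul, inv_mul_cancel₀ hc, one_smul]
    rcases behind_of_smul hf.inj (h.ne₂ hb) h3 with h4 | h4 | h4 | h4 | h4
    · exact h.adj.ne h4
    · exact h.ne₁ hb h4.symm
    · exact hf.not_adj h4 h.adj.symm
    · exact hY _ h4
    · exact hX _ h4.symm

/-- Hiding from `c₁` matches the first two columns bijectively and monotonically, hence row by row.
-/
theorem behind_second (h : IsSlantedGrid G S c₁ c₂ g) (hf : IsVisibility G f) {k : ℕ}
    (hk : S 1 k) : Behind f c₁ (g 1 k) (g 2 k) := by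
  have hX : ∀ v, ¬ Behind f c₁ c₂ v := fun v => h.not_behind_convergence hf
  induction k using Nat.strong_induction_on with
  | _ k ih =>
    have hk2 := h.two_left hk
    obtain ⟨j, hj, hb⟩ := h.exists_first hf hX hk2 le_rfl
    rcases lt_trichotomy j k with hjk | rfl | hjk
    · have hj2 := h.two_left hj
      have := hf.eq_of_behind_of_adj hb (ih j hjk hj) ((h.adj_iff hj hk2).2 (by omega))
        ((h.adj_iff hj hj2).2 (by omega))
      have := (h.inj hk2 hj2 this).2
      omega
    · exact hb
    · obtain ⟨l, hl, hbl⟩ := h.exists_second hf hX hk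
      rcases lt_trichotomy l k with hlk | rfl | hlk
      · have := hf.eq_of_adj_of_behind hbl (ih l hlk hl) ((h.adj₁ hk).2 rfl) ((h.adj₁ hl).2 rfl)
        have := (h.inj hk hl this).2
        omega
      · exact hbl
      · have := h.first_lt_first hf hj hk hk hl hb hbl hlk
        omega

theorem row (h : IsSlantedGrid G S c₁ c₂ g) (hf : IsVisibility G f) {i j k : ℕ}
    (hi : 1 ≤ i) (hk : S k j) (hik : i < k) : Behind f c₁ (g i j) (g k j) := by
  refine h.row_ordered hf (fun l hl h2 => ?_) hi hk hik
  rcases h2.eq_or_lt with rfl | h3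
  · exact h.behind_second hf (h.first hl)
  · exact h.behind_row hf (fun v => h.not_behind_convergence hf) hl h3

/-- No vertices outside the row lie on the line spanned by a row. -/
theorem row_only (h : IsSlantedGrid G S c₁ c₂ g) (hf : IsVisibility G f) {j : ℕ} (hj : S 1 j)
    {v : V} {c : ℝ} (hv : f v - f c₁ = c • (f (g 1 j) - f c₁)) :
    v = c₁ ∨ ∃ i, S i j ∧ v = g i j := by
  have hX : ∀ v, ¬ Behind f c₁ c₂ v := fun v => h.not_behind_convergence hf
  have hY : ∀ v, ¬ Behind f c₂ c₁ v := fun v => h.swap.not_behind_convergence hf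
  -- The first column lies on a ray from `c₂`; if `c₁` were between two of its vertices, the nearer
  -- one would block `c₂` from `c₁`.
  have key : ∀ k, S 1 k → ¬ Behind f (g 1 j) c₁ (g 1 k) := by
    intro k hk hb
    rcases lt_trichotomy j k with h1 | rfl | h1
    · exact hf.not_adj ((h.swap.row hf (h.pos hj).2 hk h1).of_between hb) h.adj.symm
    · exact hb.ne rfl
    · exact hf.not_adj ((h.swap.row hf (h.pos hk).2 hj h1).of_between hb.symm)
        h.adj.symm
  rcases behind_of_smul hf.inj (h.ne₁ hj) hv with h1 | h1 | h1 | h1 | h1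
  · exact Or.inl h1
  · exact Or.inr ⟨1, hj, h1⟩
  · right
    by_cases ha : G.Adj (g 1 j) v
    · refine ⟨2, h.two_left hj, hf.eq_of_behind_of_adj h1 (h.behind_second hf hj) ha ?_⟩
      exact (h.adj_iff hj (h.two_left hj)).2 (by omega)
    · rcases h.cases v with rfl | rfl | ⟨i, l, hs, rfl⟩
      · exact (h1.ne rfl).elim
      · exact (hf.not_adj h1 h.adj).elim
      · have : i ≠ 1 := fun hi => hf.not_adj h1 ((h.adj₁ hs).2 hi)
        rw [h.adj_iff hj hs] at ha
        have : l = j := by omega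
        subst this
        exact ⟨i, hs, rfl⟩
  · exact (hf.not_adj h1 ((h.adj₁ hj).2 rfl)).elim
  · exfalso
    rcases h.cases v with rfl | rfl | ⟨i, l, hs, rfl⟩
    · exact h1.ne_right rfl
    · exact hY _ h1.symm
    · by_cases hi : i = 1
      · subst hi
        exact key l hs h1
      · obtain ⟨k, hk, hb⟩ := h.exists_first hf hX hs (by have := (h.pos hs).1; omega)
        exact key k hk (h1.of_between hb)

end IsSlantedGrid

end

/-! ### Lines as ordered lists, and their preservation -/

section LineSequences

variable {V : Type*} {G : SimpleGraph V} {f : V → Plane}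

theorem behind_iff_mem_segment {E : Type*} [AddCommGroup E] [Module ℝ E] {f : V → E} {u w v : V} :
    Behind f u w v ↔ f w ∈ segment ℝ (f u) (f v) ∧ f w ≠ f u ∧ f w ≠ f v := by
  constructor
  · intro h
    refine ⟨?_, h.1, h.ne_right⟩
    obtain ⟨hne, μ, hμ, h⟩ := h
    rw [segment_eq_image']
    refine ⟨μ⁻¹, ⟨by positivity, inv_le_one_of_one_le₀ hμ.le⟩, ?_⟩
    simp only
    rw [h, smul_smul, inv_mul_cancel₀ (by linarith), one_smul]
    abel
  · rintro ⟨h, hu, hv⟩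
    rw [segment_eq_image'] at h
    obtain ⟨θ, ⟨h0, h1⟩, h⟩ := h
    simp only at h
    have h0' : θ ≠ 0 := by
      rintro rfl
      rw [zero_smul, add_zero] at h
      exact hu h.symm
    have h1' : θ ≠ 1 := by
      rintro rfl
      rw [one_smul, add_sub_cancel] at h
      exact hv h.symm
    have h0 : 0 < θ := lt_of_le_of_ne h0 h0'.symm
    refine ⟨hu, θ⁻¹, (one_lt_inv₀ h0).2 (lt_of_le_of_ne h1 h1'), ?_⟩
    rw [← h, add_sub_cancel_left, smul_smul, inv_mul_cancel₀ h0', one_smul]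

theorem isVisibilityEmbedding_iff : IsVisibilityEmbedding G f ↔ IsVisibility G f := by
  have key : ∀ u v, (Set.range f ∩ segment ℝ (f u) (f v) = {f u, f v} ↔
      ∀ w, ¬ Behind f u w v) := by
    intro u v
    simp only [behind_iff_mem_segment]
    constructor
    · rintro h w ⟨h1, h2, h3⟩
      have : f w ∈ Set.range f ∩ segment ℝ (f u) (f v) := ⟨⟨w, rfl⟩, h1⟩
      rw [h] at this
      rcases this with h4 | h4
      · exact h2 h4
      · exact h3 h4
    · intro h
      ext p
      constructor
      · rintro ⟨⟨w, rfl⟩, hw⟩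
        by_contra hcon
        rw [Set.mem_insert_iff, Set.mem_singleton_iff, not_or] at hcon
        exact h w ⟨hw, hcon.1, hcon.2⟩
      · rintro (rfl | rfl)
        · exact ⟨⟨u, rfl⟩, left_mem_segment ℝ _ _⟩
        · exact ⟨⟨v, rfl⟩, right_mem_segment ℝ _ _⟩
  constructor
  · rintro ⟨hi, h⟩
    exact ⟨hi, fun u v huv => (h u v huv).trans (key u v)⟩
  · rintro ⟨hi, h⟩
    exact ⟨hi, fun u v huv => (h u v huv).trans (key u v).symm⟩

/-- With `c` as origin and the vector from `c` to `x` as unit, betweenness becomes the order of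
coordinates. -/
theorem isLineSequence_of_behind {c x : V} {l : List V} (hx : x ∈ l) (hxc : f x ≠ f c)
    (hl : ∀ v ∈ l, v = x ∨ Behind f c x v) (hp : l.Pairwise (Behind f c))
    (hall : ∀ v, ∀ s : ℝ, f v - f c = s • (f x - f c) → v ∈ c :: l) :
    IsLineSequence f (c :: l) := by
  classical
  have hd : f x - f c ≠ 0 := sub_ne_zero.2 hxc
  have hunique : ∀ {s s' : ℝ}, s • (f x - f c) = s' • (f x - f c) → s = s' :=
    fun h => smul_left_injective ℝ hd h
  -- The default `0` is taken only off the line, where `t` plays no role.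
  set t : V → ℝ := fun v =>
    if h : ∃ s : ℝ, f v - f c = s • (f x - f c) then h.choose else 0 with ht
  have hts : ∀ {v} {s : ℝ}, f v - f c = s • (f x - f c) → t v = s := by
    intro v s h
    have hex : ∃ s : ℝ, f v - f c = s • (f x - f c) := ⟨s, h⟩
    have h1 : t v = hex.choose := by simp only [ht, dif_pos hex]
    rw [h1]
    exact hunique (hex.choose_spec.symm.trans h)
  have hl' : ∀ v ∈ l, f v - f c = t v • (f x - f c) ∧ 1 ≤ t v := by
    intro v hv
    rcases hl v hv with rfl | ⟨-, μ, hμ, h⟩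
    · have : f v - f c = (1 : ℝ) • (f v - f c) := (one_smul _ _).symm
      rw [hts this]
      exact ⟨this, le_rfl⟩
    · rw [hts h]
      exact ⟨h, hμ.le⟩
  have htc : t c = 0 := hts (by rw [sub_self, zero_smul])
  refine ⟨?_, f c, f x - f c, t, hd, ?_, ?_, ?_⟩
  · have := List.length_pos_of_mem hx
    rw [List.length_cons]
    omega
  · intro v hv
    rcases List.mem_cons.1 hv with rfl | hv
    · rw [htc, zero_smul, add_zero]
    · rw [← (hl' v hv).1]
      abel
  · rw [List.pairwise_cons]
    refine ⟨fun v hv => by rw [htc]; linarith [(hl' v hv).2], ?_⟩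
    refine List.Pairwise.imp_of_mem (fun {a b} ha hb hab => ?_) hp
    obtain ⟨-, μ, hμ, h⟩ := hab
    obtain ⟨h1, h2⟩ := hl' a ha
    rw [h1, smul_smul] at h
    rw [hts h]
    nlinarith
  · intro v hv s h
    exact hv (hall v s (by rw [h]; abel))

theorem IsLineSequence.reverse {L : List V} (h : IsLineSequence f L) :
    IsLineSequence f L.reverse := by
  obtain ⟨hlen, p, d, t, hd, hm, hp, ho⟩ := h
  refine ⟨by rwa [List.length_reverse], p, -d, fun v => - t v, neg_ne_zero.2 hd, ?_, ?_, ?_⟩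
  · intro v hv
    rw [smul_neg, neg_smul, neg_neg]
    exact hm v (List.mem_reverse.1 hv)
  · rw [List.pairwise_reverse]
    exact hp.imp (fun h => neg_lt_neg h)
  · intro v hv s
    rw [smul_neg, ← neg_smul]
    exact ho v (fun h => hv (List.mem_reverse.2 h)) _

theorem IsLineSequence.mem_of_smul {L : List V} (h : IsLineSequence f L) {u w v : V} (hu : u ∈ L)
    (hw : w ∈ L) {c : ℝ} (hv : f v - f u = c • (f w - f u)) : v ∈ L := by
  obtain ⟨hlen, p, d, t, hd, hm, hp, ho⟩ := h
  by_contra hcon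
  apply ho v hcon (t u + c * (t w - t u))
  have : f v = f u + c • (f w - f u) := by rw [← hv]; abel
  rw [this, hm u hu, hm w hw]
  module

theorem eq_of_pairwise_lt {t : V → ℝ} {L M : List V} (hL : L.Pairwise fun u v => t u < t v)
    (hM : M.Pairwise fun u v => t u < t v) (h : ∀ v, v ∈ L ↔ v ∈ M) : L = M := by
  have hnd : ∀ {K : List V}, K.Pairwise (fun u v => t u < t v) → K.Nodup :=
    fun hK => hK.imp (fun h h' => by rw [h'] at h; exact lt_irrefl _ h)
  have hperm : L.Perm M := (List.perm_ext_iff_of_nodup (hnd hL) (hnd hM)).2 h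
  exact hperm.eq_of_pairwise (fun a b _ _ h h' => (lt_asymm h h').elim) hL hM

/-- A line is determined, up to reversal, by two of its points. -/
theorem IsLineSequence.eq_or_eq_reverse {L M : List V} (hL : IsLineSequence f L)
    (hM : IsLineSequence f M) {u w : V} (huw : f u ≠ f w) (huL : u ∈ L) (hwL : w ∈ L)
    (huM : u ∈ M) (hwM : w ∈ M) : L = M ∨ L = M.reverse := by
  obtain ⟨-, p, d, t, hd, hm, hp, ho⟩ := hL
  obtain ⟨-, q, e, s, he, hm', hp', ho'⟩ := hM
  have hsub : (t w - t u) • d = (s w - s u) • e := by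
    have h1 : (t w - t u) • d = f w - f u := by rw [hm u huL, hm w hwL]; module
    have h2 : (s w - s u) • e = f w - f u := by rw [hm' u huM, hm' w hwM]; module
    rw [h1, h2]
  have hsne : s w - s u ≠ 0 := by
    intro h0
    apply huw
    rw [hm' u huM, hm' w hwM, sub_eq_zero.1 h0]
  have htne : t w - t u ≠ 0 := by
    intro h0
    apply huw
    rw [hm u huL, hm w hwL, sub_eq_zero.1 h0]
  -- The ratio of the two direction vectors; its sign decides between `M` and its reverse.
  set c := (s w - s u)⁻¹ * (t w - t u) with hc
  have hcne : c ≠ 0 := mul_ne_zero (inv_ne_zero hsne) htne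
  have hec : e = c • d := by
    rw [hc, mul_smul, hsub, smul_smul, inv_mul_cancel₀ hsne, one_smul]
  have hpq : q = p + (t u - s u * c) • d := by
    have h1 := hm u huL
    rw [hm' u huM, hec] at h1
    have : q = (q + s u • c • d) - (s u * c) • d := by module
    rw [this, h1]
    module
  have hto : ∀ x : ℝ, q + x • e = p + (t u - s u * c + x * c) • d := by
    intro x
    rw [hpq, hec]
    module
  have hmem : ∀ v, v ∈ L ↔ v ∈ M := by
    intro v
    constructor
    · intro hv
      by_contra hcon
      apply ho' v hcon ((t v - (t u - s u * c)) * c⁻¹)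
      rw [hto, hm v hv, mul_assoc, inv_mul_cancel₀ hcne]
      module
    · intro hv
      by_contra hcon
      exact ho v hcon _ ((hm' v hv).trans (hto _))
  have ht : ∀ v ∈ M, t v = t u - s u * c + s v * c := by
    intro v hv
    have h1 := (hm v ((hmem v).2 hv)).symm.trans ((hm' v hv).trans (hto _))
    exact smul_left_injective ℝ hd (add_left_cancel h1)
  rcases lt_or_gt_of_ne hcne with hneg | hpos
  · right
    refine eq_of_pairwise_lt hp ?_ (fun v => (hmem v).trans List.mem_reverse.symm)
    rw [List.pairwise_reverse]
    refine hp'.imp_of_mem (fun {a b} ha hb hab => ?_)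
    rw [ht a ha, ht b hb]
    nlinarith
  · left
    refine eq_of_pairwise_lt hp ?_ hmem
    refine hp'.imp_of_mem (fun {a b} ha hb hab => ?_)
    rw [ht a ha, ht b hb]
    nlinarith

/-- If every two vertices that do not see each other lie on a common line of a family of lines
preserved from `f` to `f'`, then every line of `f` is preserved in `f'`. -/
theorem isPreservedIn_of_family {f' : V → Plane} (hf : IsVisibility G f)
    (hf' : IsVisibility G f') {P : List V → Prop} (hP : ∀ M, P M → IsLineSequence f M)
    (hP' : ∀ M, P M → IsLineSequence f' M)
    (hadj : ∀ u v, u ≠ v → ¬ G.Adj u v → ∃ M, P M ∧ u ∈ M ∧ v ∈ M) {L : List V}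
    (hL : IsLineSequence f L) : IsPreservedIn L f' := by
  have hends : ∀ {k : V → Plane}, IsVisibility G k → ∀ {u w v}, Behind k u w v →
      ∃ M, P M ∧ u ∈ M ∧ v ∈ M := by
    intro k hk u w v hb
    exact hadj u v (fun he => hb.ne (by rw [he])) (hk.not_adj hb)
  match L, hL with
  | [], hL => exact absurd hL.1 (by simp)
  | [u], hL => exact absurd hL.1 (by simp)
  | [u, v], hL =>
    have huv : u ≠ v := by
      obtain ⟨-, p, d, t, hd, hm, hp, ho⟩ := hL
      rintro rfl
      simp at hp
    -- In `f`, a family line through `u` and `v` is the two-point line itself. A third point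
    -- collinear with them in `f'` would produce, from the two outer points, a family line
    -- containing all three.
    have hfam : ∀ {M}, P M → u ∈ M → v ∈ M → ∀ {x}, x ∈ M → x ∈ [u, v] := by
      intro M hM hu hv x hx
      rcases hL.eq_or_eq_reverse (hP M hM) (hf.inj.ne huv) (by simp) (by simp) hu hv with h | h
      · rwa [h]
      · rwa [h, List.mem_reverse]
    refine isLineSequence_of_behind (x := v) (by simp) (hf'.inj.ne huv.symm) (by simp) (by simp) ?_
    intro x s hx
    have hmem : ∀ {a b c}, Behind f' a b c → ∃ M, P M ∧ a ∈ M ∧ c ∈ M ∧ b ∈ M := by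
      intro a b c hb
      obtain ⟨M, hM, ha, hc⟩ := hends hf' hb
      obtain ⟨-, κ, hκ, he⟩ := hb
      refine ⟨M, hM, ha, hc, (hP' M hM).mem_of_smul ha hc (c := κ⁻¹) ?_⟩
      rw [he, smul_smul, inv_mul_cancel₀ (by linarith), one_smul]
    rcases behind_of_smul hf'.inj huv.symm hx with h1 | h1 | h1 | h1 | h1
    · simp [h1]
    · simp [h1]
    · obtain ⟨M, hM, ha, hc, hb⟩ := hmem h1
      exact hfam hM ha hb hc
    · obtain ⟨M, hM, ha, hc, hb⟩ := hmem h1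
      exact hfam hM ha hc hb
    · obtain ⟨M, hM, ha, hc, hb⟩ := hmem h1
      exact hfam hM hb ha hc
  | u :: v :: w :: l, hL =>
    -- The first and third points do not see each other, so a family line carries both and equals
    -- `L` up to reversal.
    obtain ⟨M, hM, hu, hw, huw⟩ : ∃ M, P M ∧ u ∈ M ∧ w ∈ M ∧ f u ≠ f w := by
      obtain ⟨-, p, d, t, hd, hm, hp, ho⟩ := hL
      simp only [List.pairwise_cons, List.mem_cons, forall_eq_or_imp] at hp
      have huv : t u < t v := hp.1.1
      have hvw : t v < t w := hp.2.1.1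
      have e1 := hm u (by simp)
      have e2 := hm v (by simp)
      have e3 := hm w (by simp)
      have hb : Behind f u v w := by
        refine ⟨?_, (t w - t u) / (t v - t u), ?_, ?_⟩
        · rw [e1, e2]
          intro he
          exact huv.ne' (smul_left_injective ℝ hd (add_left_cancel he))
        · rw [lt_div_iff₀ (by linarith)]
          linarith
        · have : t v - t u ≠ 0 := by linarith
          rw [e1, e2, e3]
          match_scalars <;> field_simp <;> ring
      obtain ⟨M, hM, hu, hw⟩ := hends hf hb
      exact ⟨M, hM, hu, hw, hb.ne.symm⟩
    rcases hL.eq_or_eq_reverse (hP M hM) huw (by simp) (by simp) hu hw with h | h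
    · rw [h]
      exact hP' M hM
    · rw [h]
      exact (hP' M hM).reverse

end LineSequences

/-! ### A projective chart -/

section Projection

variable {V : Type*}

/-- The point with homogeneous coordinates `x`, `y`, `z`, in the chart in which the line
`x + y + z = 0` is at infinity. -/
noncomputable def chartPoint (x y z : ℝ) : Plane := !₂[x / (x + y + z), y / (x + y + z)]

/-- Rescaling weights by the positive coordinate sums turns convex combinations in the chart into
nonnegative combinations of homogeneous coordinates, and back. This treats points with `z = 0` like
all others. -/
theorem chartPoint_mem_segment {x y z : V → ℝ} (hs : ∀ v, 0 < x v + y v + z v) {u v w : V} :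
    chartPoint (x w) (y w) (z w) ∈
        segment ℝ (chartPoint (x u) (y u) (z u)) (chartPoint (x v) (y v) (z v)) ↔
      ∃ α β : ℝ, 0 ≤ α ∧ 0 ≤ β ∧ x w = α * x u + β * x v ∧ y w = α * y u + β * y v ∧
        z w = α * z u + β * z v := by
  have hu := hs u
  have hv := hs v
  have hw := hs w
  have hu' := hu.ne'
  have hv' := hv.ne'
  have hw' := hw.ne'
  have hcoord : ∀ a b : ℝ, a • chartPoint (x u) (y u) (z u) + b • chartPoint (x v) (y v) (z v) =
      chartPoint (x w) (y w) (z w) ↔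
      a * (x u / (x u + y u + z u)) + b * (x v / (x v + y v + z v)) =
          x w / (x w + y w + z w) ∧
        a * (y u / (x u + y u + z u)) + b * (y v / (x v + y v + z v)) =
          y w / (x w + y w + z w) := by
    intro a b
    rw [PiLp.ext_iff, Fin.forall_fin_two]
    simp [chartPoint]
  constructor
  · rintro ⟨a, b, ha, hb, hab, h⟩
    obtain ⟨h1, h2⟩ := (hcoord a b).1 h
    have ex : x w = (x w + y w + z w) *
        (a * (x u / (x u + y u + z u)) + b * (x v / (x v + y v + z v))) := by
      rw [h1]; field_simp
    have ey : y w = (x w + y w + z w) *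
        (a * (y u / (x u + y u + z u)) + b * (y v / (x v + y v + z v))) := by
      rw [h2]; field_simp
    have ez : z w = (x w + y w + z w) *
        (a * (z u / (x u + y u + z u)) + b * (z v / (x v + y v + z v))) := by
      have e1 : z w = (x w + y w + z w) - x w - y w := by ring
      have e2 : ∀ t, 0 < x t + y t + z t → z t / (x t + y t + z t) =
          1 - x t / (x t + y t + z t) - y t / (x t + y t + z t) := by
        intro t ht
        field_simp
        ring
      rw [e2 u hu, e2 v hv]
      have e3 : (x w + y w + z w) * (a * (1 - x u / (x u + y u + z u) - y u / (x u + y u + z u)) +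
          b * (1 - x v / (x v + y v + z v) - y v / (x v + y v + z v))) =
          (x w + y w + z w) * (a + b) - (x w + y w + z w) *
        (a * (x u / (x u + y u + z u)) + b * (x v / (x v + y v + z v))) - (x w + y w + z w) *
        (a * (y u / (x u + y u + z u)) + b * (y v / (x v + y v + z v))) := by ring
      rw [e3, ← ex, ← ey, hab]
      ring
    refine ⟨a * (x w + y w + z w) / (x u + y u + z u), b * (x w + y w + z w) / (x v + y v + z v),
      by positivity, by positivity, ex.trans (by ring), ey.trans (by ring), ez.trans (by ring)⟩
  · rintro ⟨α, β, hα, hβ, h1, h2, h3⟩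
    refine ⟨α * (x u + y u + z u) / (x w + y w + z w), β * (x v + y v + z v) / (x w + y w + z w),
      by positivity, by positivity, ?_, ?_⟩
    · rw [← add_div, div_eq_one_iff_eq hw', h1, h2, h3]
      ring
    · rw [hcoord]
      constructor
      · rw [h1]; field_simp
      · rw [h2]; field_simp

end Projection

/-! ### Existence of an embedding -/

theorem inv_shift_lt {s : ℝ} (hs : 0 ≤ s) {a b : ℕ} (ha : 1 ≤ a) (hab : a < b) :
    ((b : ℝ) + s)⁻¹ < ((a : ℝ) + s)⁻¹ := by
  have h1 : (1 : ℝ) ≤ a := by exact_mod_cast ha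
  have h2 : (a : ℝ) < b := by exact_mod_cast hab
  exact inv_strictAnti₀ (by linarith) (by linarith)

theorem le_of_inv_shift_le {s : ℝ} (hs : 0 ≤ s) {a b : ℕ} (hb : 1 ≤ b)
    (h : ((b : ℝ) + s)⁻¹ ≤ ((a : ℝ) + s)⁻¹) : a ≤ b := by
  by_contra! hcon
  exact absurd (inv_shift_lt hs hb hcon) (not_lt.2 h)

theorem inv_shift_inj {s : ℝ} {a b : ℕ}
    (h : ((a : ℝ) + s)⁻¹ = ((b : ℝ) + s)⁻¹) : a = b := by
  have := inv_injective h
  exact_mod_cast add_right_cancel this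

theorem between_of_combination {s : ℝ} (hs : 0 ≤ s) {a i k : ℕ} (ha : 1 ≤ a) (hi : 1 ≤ i)
    (hik : i < k) {α β : ℝ} (hα : 0 ≤ α) (hβ : 0 ≤ β) (hαβ : α + β = 1)
    (h : ((a : ℝ) + s)⁻¹ = α * ((i : ℝ) + s)⁻¹ + β * ((k : ℝ) + s)⁻¹) : i ≤ a ∧ a ≤ k := by
  have h1 := inv_shift_lt hs hi hik
  obtain rfl : α = 1 - β := by linarith
  constructor
  · refine le_of_inv_shift_le hs ha ?_
    rw [h]
    nlinarith
  · refine le_of_inv_shift_le hs (by omega) ?_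
    rw [h]
    nlinarith

theorem exists_combination {s : ℝ} (hs : 0 ≤ s) {a i k : ℕ} (hi : 1 ≤ i) (hia : i < a)
    (hak : a < k) : ∃ α β : ℝ, 0 ≤ α ∧ 0 ≤ β ∧ α + β = 1 ∧
      ((a : ℝ) + s)⁻¹ = α * ((i : ℝ) + s)⁻¹ + β * ((k : ℝ) + s)⁻¹ := by
  have h1 := inv_shift_lt hs hi hia
  have h2 := inv_shift_lt hs (by omega) hak
  generalize ((a : ℝ) + s)⁻¹ = p at *
  generalize ((i : ℝ) + s)⁻¹ = q at *
  generalize ((k : ℝ) + s)⁻¹ = r at *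
  have h3 : q - r ≠ 0 := by linarith
  refine ⟨(p - r) / (q - r), (q - p) / (q - r), div_nonneg (by linarith) (by linarith),
    div_nonneg (by linarith) (by linarith), ?_, ?_⟩
  · field_simp
    ring
  · field_simp
    ring

theorem Irrational.eq_zero_of_mul_eq {s : ℝ} (hs : Irrational s) {p q : ℚ}
    (h : (p : ℝ) * s = q) : p = 0 := by
  by_contra hp
  apply hs
  refine ⟨q / p, ?_⟩
  have : (p : ℝ) ≠ 0 := by exact_mod_cast hp
  push_cast
  rw [← h]
  field_simp

/-- Of the points `(1 / i, 1 / (j + s))`, `s` irrational, no three lie on a line that is neither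
horizontal nor vertical. -/
theorem eq_of_combination {s : ℝ} (hs0 : 0 ≤ s) (hs : Irrational s) {a b i j k l : ℕ} (hb : 1 ≤ b)
    (hj : 1 ≤ j) (hl : 1 ≤ l) (hik : i ≠ k) (hjl : j ≠ l) {β : ℝ}
    (hx : (a : ℝ)⁻¹ = (1 - β) * (i : ℝ)⁻¹ + β * (k : ℝ)⁻¹)
    (hy : ((b : ℝ) + s)⁻¹ = (1 - β) * ((j : ℝ) + s)⁻¹ + β * ((l : ℝ) + s)⁻¹) :
    a = i ∧ b = j ∨ a = k ∧ b = l := by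
  have hne : (k : ℝ)⁻¹ - (i : ℝ)⁻¹ ≠ 0 := by
    intro h0
    have := inv_injective (sub_eq_zero.1 h0)
    exact hik (by exact_mod_cast this.symm)
  -- The first coordinates are rational, hence so is the weight.
  obtain ⟨q, rfl⟩ : ∃ q : ℚ, (q : ℝ) = β := by
    refine ⟨((a : ℚ)⁻¹ - (i : ℚ)⁻¹) / ((k : ℚ)⁻¹ - (i : ℚ)⁻¹), ?_⟩
    push_cast
    rw [div_eq_iff hne, hx]
    ring
  have hb' : (b : ℝ) + s ≠ 0 := by
    have : (1 : ℝ) ≤ b := by exact_mod_cast hb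
    linarith
  have hj' : (j : ℝ) + s ≠ 0 := by
    have : (1 : ℝ) ≤ j := by exact_mod_cast hj
    linarith
  have hl' : (l : ℝ) + s ≠ 0 := by
    have : (1 : ℝ) ≤ l := by exact_mod_cast hl
    linarith
  have key : ((j : ℝ) - b) * (l + s) = q * (j - l) * (b + s) := by
    field_simp at hy
    have h2 : (((j : ℝ) - b) * (l + s) - q * (j - l) * (b + s)) = 0 := by
      linear_combination hy
    linarith
  -- Since `s` is irrational, its coefficients on the two sides of `key` agree.
  have h1 : ((j : ℚ) - b - q * (j - l)) = 0 := by
    apply hs.eq_zero_of_mul_eq (q := q * (j - l) * b - (j - b) * l)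
    push_cast
    linear_combination key
  have h2 : (j : ℝ) - b - q * (j - l) = 0 := by exact_mod_cast h1
  have h3 : ((j : ℝ) - b) * (l - b) = 0 := by
    linear_combination key - (b + s) * h2
  have hjl' : (j : ℝ) - l ≠ 0 := by
    intro h0
    exact hjl (by exact_mod_cast sub_eq_zero.1 h0)
  rcases mul_eq_zero.1 h3 with h4 | h4
  · left
    have hq : (q : ℝ) = 0 := by
      rw [h4, zero_sub, neg_eq_zero] at h2
      exact (mul_eq_zero.1 h2).resolve_right hjl'
    rw [hq] at hx
    simp only [sub_zero, one_mul, zero_mul, add_zero] at hx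
    exact ⟨by exact_mod_cast inv_injective hx, by exact_mod_cast (sub_eq_zero.1 h4).symm⟩
  · right
    have hq : (q : ℝ) = 1 := by
      have : (1 - (q : ℝ)) * (j - l) = 0 := by linear_combination h2 - h4
      linarith [(mul_eq_zero.1 this).resolve_right hjl']
    rw [hq] at hx
    simp only [sub_self, one_mul, zero_mul, zero_add] at hx
    exact ⟨by exact_mod_cast inv_injective hx, by exact_mod_cast (sub_eq_zero.1 h4).symm⟩

/-- A vertex assignment with the homogeneous coordinates `(1 : 0 : 0)`, `(0 : 1 : 0)` and
`(1 / i : 1 / (j + s) : 1)`, `s` irrational, is a visibility embedding. -/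
theorem IsSlantedGrid.isVisibility_chartPoint {V : Type*} {G : SimpleGraph V} {S : ℕ → ℕ → Prop}
    {c₁ c₂ : V} {g : ℕ → ℕ → V} (h : IsSlantedGrid G S c₁ c₂ g) {s : ℝ} (hs0 : 0 ≤ s)
    (hs : Irrational s) {x y z : V → ℝ} (hx₁ : x c₁ = 1) (hy₁ : y c₁ = 0) (hz₁ : z c₁ = 0)
    (hx₂ : x c₂ = 0) (hy₂ : y c₂ = 1) (hz₂ : z c₂ = 0)
    (hx : ∀ {i j}, S i j → x (g i j) = (i : ℝ)⁻¹)
    (hy : ∀ {i j}, S i j → y (g i j) = ((j : ℝ) + s)⁻¹) (hz : ∀ {i j}, S i j → z (g i j) = 1) :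
    IsVisibility G fun v => chartPoint (x v) (y v) (z v) := by
  have hsum : ∀ v, 0 < x v + y v + z v := by
    intro v
    rcases h.cases v with rfl | rfl | ⟨i, j, hv, rfl⟩
    · rw [hx₁, hy₁, hz₁]; norm_num
    · rw [hx₂, hy₂, hz₂]; norm_num
    · rw [hx hv, hy hv, hz hv]; positivity
  let C : V → V → V → Prop := fun u v w => ∃ α β : ℝ, 0 ≤ α ∧ 0 ≤ β ∧
    x w = α * x u + β * x v ∧ y w = α * y u + β * y v ∧ z w = α * z u + β * z v
  have hCsymm : ∀ {u v w}, C u v w → C v u w := by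
    rintro u v w ⟨α, β, hα, hβ, h1, h2, h3⟩
    exact ⟨β, α, hβ, hα, by linarith, by linarith, by linarith⟩
  have hx' : ∀ {i j}, S i j → x (g i j) = ((i : ℝ) + 0)⁻¹ := fun {i j} hv => by rw [hx hv, add_zero]
  have hinj : Function.Injective fun v => chartPoint (x v) (y v) (z v) := by
    intro u v huv
    have h1 : C u u v := by
      refine (chartPoint_mem_segment hsum).1 ?_
      simp only at huv
      rw [huv]
      exact left_mem_segment ℝ _ _
    obtain ⟨α, β, hα, hβ, h1, h2, h3⟩ := h1
    rcases h.cases u with rfl | rfl | ⟨i, j, hu, rfl⟩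
    · rcases h.cases v with rfl | rfl | ⟨k, l, hv, rfl⟩
      · rfl
      · rw [hy₁, hy₂] at h2; linarith
      · rw [hz₁, hz hv] at h3; linarith
    · rcases h.cases v with rfl | rfl | ⟨k, l, hv, rfl⟩
      · rw [hx₁, hx₂] at h1; linarith
      · rfl
      · rw [hz₂, hz hv] at h3; linarith
    · rcases h.cases v with rfl | rfl | ⟨k, l, hv, rfl⟩
      · rw [hz₁, hz hu] at h3
        obtain rfl : α = 0 := by linarith
        obtain rfl : β = 0 := by linarith
        rw [hx₁] at h1
        linarith
      · rw [hz₂, hz hu] at h3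
        obtain rfl : α = 0 := by linarith
        obtain rfl : β = 0 := by linarith
        rw [hy₂] at h2
        linarith
      · rw [hz hu, hz hv, mul_one, mul_one] at h3
        rw [hx' hu, hx' hv, ← add_mul, ← h3, one_mul] at h1
        rw [hy hu, hy hv, ← add_mul, ← h3, one_mul] at h2
        rw [inv_shift_inj h1, inv_shift_inj h2]
  have hgrid : ∀ {i j k l w}, S i j → S k l → C (g i j) (g k l) w →
      ∃ a b, S a b ∧ w = g a b ∧ ∃ α β : ℝ, 0 ≤ α ∧ 0 ≤ β ∧ α + β = 1 ∧
        ((a : ℝ) + 0)⁻¹ = α * ((i : ℝ) + 0)⁻¹ + β * ((k : ℝ) + 0)⁻¹ ∧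
        ((b : ℝ) + s)⁻¹ = α * ((j : ℝ) + s)⁻¹ + β * ((l : ℝ) + s)⁻¹ := by
    rintro i j k l w hu hv ⟨α, β, hα, hβ, h1, h2, h3⟩
    rw [hz hu, hz hv] at h3
    rcases h.cases w with rfl | rfl | ⟨a, b, hw, rfl⟩
    · obtain rfl : α = 0 := by linarith
      obtain rfl : β = 0 := by linarith
      rw [hx₁] at h1
      linarith
    · obtain rfl : α = 0 := by linarith
      obtain rfl : β = 0 := by linarith
      rw [hy₂] at h2
      linarith
    · rw [hz hw] at h3
      refine ⟨a, b, hw, rfl, α, β, hα, hβ, by linarith, ?_, ?_⟩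
      · rw [← hx' hu, ← hx' hv, ← hx' hw, h1]
      · rw [← hy hu, ← hy hv, ← hy hw, h2]
  have hrow : ∀ {i j k}, S i j → S k j → i < k →
      (G.Adj (g i j) (g k j) ↔ ∀ w, C (g i j) (g k j) w → w = g i j ∨ w = g k j) := by
    intro i j k hu hv hik
    have hi := (h.pos hu).1
    rw [h.adj_iff hu hv]
    constructor
    · intro hk w hw
      obtain ⟨a, b, hab, rfl, α, β, hα, hβ, hαβ, h1, h2⟩ := hgrid hu hv hw
      rw [← add_mul, hαβ, one_mul] at h2
      obtain rfl := inv_shift_inj h2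
      have := between_of_combination le_rfl (h.pos hab).1 hi hik hα hβ hαβ h1
      rcases this.1.eq_or_lt with rfl | h3
      · exact Or.inl rfl
      · obtain rfl : a = k := by omega
        exact Or.inr rfl
    · intro hw
      by_contra hcon
      obtain ⟨α, β, hα, hβ, hαβ, he⟩ :=
        exists_combination le_rfl hi (lt_add_one i) (show i + 1 < k by omega)
      have hm : S (i + 1) j := h.left hv (by omega) (by omega)
      have := hw (g (i + 1) j) ⟨α, β, hα, hβ, by rw [hx' hu, hx' hv, hx' hm, he],
        by rw [hy hu, hy hv, hy hm, ← add_mul, hαβ, one_mul],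
        by rw [hz hu, hz hv, hz hm, mul_one, mul_one, hαβ]⟩
      rcases this with h3 | h3
      · have := (h.inj hm hu h3).1
        omega
      · have := (h.inj hm hv h3).1
        omega
  have hcol : ∀ {i j l}, S i j → S i l → j < l →
      (G.Adj (g i j) (g i l) ↔ ∀ w, C (g i j) (g i l) w → w = g i j ∨ w = g i l) := by
    intro i j l hu hv hjl
    have hj := (h.pos hu).2
    rw [h.adj_iff hu hv]
    constructor
    · intro hk w hw
      obtain ⟨a, b, hab, rfl, α, β, hα, hβ, hαβ, h1, h2⟩ := hgrid hu hv hw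
      rw [← add_mul, hαβ, one_mul] at h1
      obtain rfl := inv_shift_inj h1
      have := between_of_combination hs0 (h.pos hab).2 hj hjl hα hβ hαβ h2
      rcases this.1.eq_or_lt with rfl | h3
      · exact Or.inl rfl
      · obtain rfl : b = l := by omega
        exact Or.inr rfl
    · intro hw
      by_contra hcon
      obtain ⟨α, β, hα, hβ, hαβ, he⟩ :=
        exists_combination hs0 hj (lt_add_one j) (show j + 1 < l by omega)
      have hm : S i (j + 1) := h.up hv (by omega) (by omega)
      have := hw (g i (j + 1)) ⟨α, β, hα, hβ,
        by rw [hx hu, hx hv, hx hm, ← add_mul, hαβ, one_mul], by rw [hy hu, hy hv, hy hm, he],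
        by rw [hz hu, hz hv, hz hm, mul_one, mul_one, hαβ]⟩
      rcases this with h3 | h3
      · have := (h.inj hm hu h3).2
        omega
      · have := (h.inj hm hv h3).2
        omega
  have hgeneric : ∀ {i j k l}, S i j → S k l → i ≠ k → j ≠ l →
      (G.Adj (g i j) (g k l) ↔ ∀ w, C (g i j) (g k l) w → w = g i j ∨ w = g k l) := by
    intro i j k l hu hv hik hjl
    refine iff_of_true ((h.adj_iff hu hv).2 (Or.inl ⟨hik, hjl⟩)) fun w hw => ?_
    obtain ⟨a, b, hab, rfl, α, β, hα, hβ, hαβ, h1, h2⟩ := hgrid hu hv hw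
    obtain rfl : α = 1 - β := by linarith
    simp only [add_zero] at h1
    rcases eq_of_combination hs0 hs (h.pos hab).2 (h.pos hu).2 (h.pos hv).2 hik hjl h1 h2 with
      ⟨rfl, rfl⟩ | ⟨rfl, rfl⟩
    · exact Or.inl rfl
    · exact Or.inr rfl
  have hc₁ : ∀ {i j}, S i j →
      (G.Adj c₁ (g i j) ↔ ∀ w, C c₁ (g i j) w → w = c₁ ∨ w = g i j) := by
    intro i j hv
    rw [h.adj₁ hv]
    constructor
    · rintro rfl w ⟨α, β, hα, hβ, h1, h2, h3⟩
      rw [hx₁, hx' hv] at h1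
      rw [hy₁, hy hv] at h2
      rw [hz₁, hz hv] at h3
      rcases h.cases w with rfl | rfl | ⟨a, b, hw, rfl⟩
      · exact Or.inl rfl
      · rw [hz₂] at h3
        obtain rfl : β = 0 := by linarith
        rw [hy₂] at h2
        linarith
      · rw [hz hw] at h3
        obtain rfl : β = 1 := by linarith
        rw [hy hw, mul_zero, zero_add, one_mul] at h2
        rw [hx' hw] at h1
        -- Here `1 / a = α + 1 ≥ 1`.
        have h4 := le_of_inv_shift_le (a := a) (b := 1) le_rfl le_rfl (by linarith)
        have := (h.pos hw).1
        obtain rfl : a = 1 := by omega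
        rw [inv_shift_inj h2]
        exact Or.inr rfl
    · intro hw
      by_contra hi
      have hm := h.first hv
      have hi := inv_shift_lt (s := 0) le_rfl le_rfl
        (show 1 < i by have := (h.pos hv).1; omega)
      -- In homogeneous coordinates, `g 1 j` is `(1 - 1/i) • c₁ + g i j`.
      rcases hw (g 1 j) ⟨_, 1, sub_nonneg.2 hi.le, zero_le_one,
        by rw [hx₁, hx' hv, hx' hm]; ring, by rw [hy₁, hy hv, hy hm]; ring,
        by rw [hz₁, hz hv, hz hm]; ring⟩ with h3 | h3
      · exact h.ne₁ hm h3
      · have := (h.inj hm hv h3).1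
        omega
  have hc₂ : ∀ {i j}, S i j →
      (G.Adj c₂ (g i j) ↔ ∀ w, C c₂ (g i j) w → w = c₂ ∨ w = g i j) := by
    intro i j hv
    rw [h.adj₂ hv]
    constructor
    · rintro rfl w ⟨α, β, hα, hβ, h1, h2, h3⟩
      rw [hx₂, hx' hv] at h1
      rw [hy₂, hy hv] at h2
      rw [hz₂, hz hv] at h3
      rcases h.cases w with rfl | rfl | ⟨a, b, hw, rfl⟩
      · rw [hz₁] at h3
        obtain rfl : β = 0 := by linarith
        rw [hx₁] at h1
        linarith
      · exact Or.inl rfl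
      · rw [hz hw] at h3
        obtain rfl : β = 1 := by linarith
        rw [hx' hw, mul_zero, zero_add, one_mul] at h1
        rw [hy hw] at h2
        have h4 := le_of_inv_shift_le (a := b) (b := 1) hs0 le_rfl (by linarith)
        have := (h.pos hw).2
        obtain rfl : b = 1 := by omega
        rw [inv_shift_inj h1]
        exact Or.inr rfl
    · intro hw
      by_contra hj
      have hm : S i 1 := h.swap.first hv
      have hj := inv_shift_lt hs0 le_rfl (show 1 < j by have := (h.pos hv).2; omega)
      rcases hw (g i 1) ⟨_, 1, sub_nonneg.2 hj.le, zero_le_one,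
        by rw [hx₂, hx hv, hx hm]; ring, by rw [hy₂, hy hv, hy hm]; ring,
        by rw [hz₂, hz hv, hz hm]; ring⟩ with h3 | h3
      · exact h.ne₂ hm h3
      · have := (h.inj hm hv h3).2
        omega
  have hcc : G.Adj c₁ c₂ ↔ ∀ w, C c₁ c₂ w → w = c₁ ∨ w = c₂ := by
    refine iff_of_true h.adj ?_
    rintro w ⟨α, β, hα, hβ, h1, h2, h3⟩
    rcases h.cases w with rfl | rfl | ⟨a, b, hw, rfl⟩
    · exact Or.inl rfl
    · exact Or.inr rfl
    · rw [hz hw, hz₁, hz₂] at h3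
      linarith
  have hsymm : ∀ {u v}, (G.Adj u v ↔ ∀ w, C u v w → w = u ∨ w = v) →
      (G.Adj v u ↔ ∀ w, C v u w → w = v ∨ w = u) := by
    intro u v huv
    rw [G.adj_comm, huv]
    exact forall_congr' fun w => ⟨fun h1 h2 => (h1 (hCsymm h2)).symm,
      fun h1 h2 => (h1 (hCsymm h2)).symm⟩
  have hall : ∀ u v, u ≠ v → (G.Adj u v ↔ ∀ w, C u v w → w = u ∨ w = v) := by
    intro u v huv
    rcases h.cases u with rfl | rfl | ⟨i, j, hu, rfl⟩
    · rcases h.cases v with rfl | rfl | ⟨k, l, hv, rfl⟩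
      · exact (huv rfl).elim
      · exact hcc
      · exact hc₁ hv
    · rcases h.cases v with rfl | rfl | ⟨k, l, hv, rfl⟩
      · exact hsymm hcc
      · exact (huv rfl).elim
      · exact hc₂ hv
    · rcases h.cases v with rfl | rfl | ⟨k, l, hv, rfl⟩
      · exact hsymm (hc₁ hu)
      · exact hsymm (hc₂ hu)
      · rcases lt_trichotomy i k with hik | rfl | hik
        · by_cases hjl : j = l
          · subst hjl
            exact hrow hu hv hik
          · exact hgeneric hu hv hik.ne hjl
        · rcases lt_trichotomy j l with hjl | rfl | hjl
          · exact hcol hu hv hjl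
          · exact (huv rfl).elim
          · exact hsymm (hcol hv hu hjl)
        · by_cases hjl : j = l
          · subst hjl
            exact hsymm (hrow hv hu hik)
          · exact hgeneric hu hv hik.ne' hjl
  refine ⟨hinj, fun u v huv => (hall u v huv).trans (forall_congr' fun w => ?_)⟩
  rw [behind_iff_mem_segment]
  rw [chartPoint_mem_segment hsum]
  have h1 : ∀ u v, chartPoint (x u) (y u) (z u) = chartPoint (x v) (y v) (z v) ↔ u = v :=
    fun u v => hinj.eq_iff (a := u) (b := v)
  rw [ne_eq, ne_eq, h1, h1]
  change (C u v w → w = u ∨ w = v) ↔ ¬(C u v w ∧ ¬w = u ∧ ¬w = v)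
  clear_value C
  tauto

/-! ### The modified slanted grid graph as a slanted grid -/

/-- The grid vertex in column `i` and row `j`, with the junk value `c₁` outside the grid. -/
def gridVertex (n i j : ℕ) : MSGGVertex n :=
  if h : InGrid n i j then .grid i j h else .c₁

theorem gridVertex_eq {n i j : ℕ} (h : InGrid n i j) : gridVertex n i j = .grid i j h :=
  dif_pos h

instance (n : ℕ) : Finite (MSGGVertex n) := by
  -- Grid indices start at `1`, so pairs with first entry `0` are free for `c₁` and `c₂`.
  let e : MSGGVertex n → ℕ × ℕ
    | .c₁ => (0, 0)
    | .c₂ => (0, 1)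
    | .grid i j _ => (i, j)
  refine Finite.of_injective
    (β := ↥(Finset.range (n + 2 * n ^ 4 + 3) ×ˢ Finset.range (n + 25 * n ^ 8 + 3)))
    (fun v => ⟨e v, ?_⟩) ?_
  · cases v with
    | c₁ => simp [e]
    | c₂ => simp [e]
    | grid i j h =>
      simp only [e, Finset.mem_product, Finset.mem_range]
      unfold InGrid at h
      omega
  · intro u v huv
    have huv : e u = e v := congrArg Subtype.val huv
    cases u with
    | c₁ => cases v with
      | c₁ => rfl
      | c₂ => simp [e] at huv
      | grid i j h => simp only [e, Prod.mk.injEq] at huv; omega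
    | c₂ => cases v with
      | c₁ => simp [e] at huv
      | c₂ => rfl
      | grid i j h => simp only [e, Prod.mk.injEq] at huv; omega
    | grid k l h' => cases v with
      | c₁ => simp only [e, Prod.mk.injEq] at huv; omega
      | c₂ => simp only [e, Prod.mk.injEq] at huv; omega
      | grid i j h =>
        simp only [e, Prod.mk.injEq] at huv
        obtain ⟨rfl, rfl⟩ := huv
        rfl

theorem gapWidth_le (n : ℕ) : gapWidth n ≤ n / 2 :=
  Nat.div_le_div_right (Nat.sqrt_le_self n)

/-- As `gapWidth n ≤ n / 2`, the deleted block misses the first two columns as well as the first two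
rows, and the extensions give these length at least four even for `n = 2`. -/
theorem isSlantedGrid_msgg {n : ℕ} (hn : 2 ≤ n) :
    IsSlantedGrid (msgg n) (InGrid n) .c₁ .c₂ (gridVertex n) := by
  have ha : 16 ≤ n ^ 4 := le_trans (by norm_num) (Nat.pow_le_pow_left hn 4)
  have hb : 16 ≤ n ^ 8 := le_trans (by norm_num) (Nat.pow_le_pow_left hn 8)
  have hg := gapWidth_le n
  exact
  { pos := fun h => by unfold InGrid at h; omega
    left := fun h h1 h2 => by unfold InGrid at *; omega
    up := fun h h1 h2 => by unfold InGrid at *; omega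
    two_left := fun h => by unfold InGrid at *; omega
    two_up := fun h => by unfold InGrid at *; omega
    four_left := by unfold InGrid; omega
    four_up := by unfold InGrid; omega
    cases := by
      rintro (_ | _ | ⟨i, j, h⟩)
      · exact Or.inl rfl
      · exact Or.inr (Or.inl rfl)
      · exact Or.inr (Or.inr ⟨i, j, h, (gridVertex_eq h).symm⟩)
    inj := fun h h' he => by
      rw [gridVertex_eq h, gridVertex_eq h'] at he
      injection he with h1 h2
      exact ⟨h1, h2⟩
    ne₁ := fun h => by rw [gridVertex_eq h]; exact fun he => nomatch he
    ne₂ := fun h => by rw [gridVertex_eq h]; exact fun he => nomatch he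
    adj := by simp [msgg, SimpleGraph.fromRel_adj, msggRel]
    adj₁ := fun h => by
      rw [gridVertex_eq h]
      simp [msgg, SimpleGraph.fromRel_adj, msggRel]
    adj₂ := fun h => by
      rw [gridVertex_eq h]
      simp [msgg, SimpleGraph.fromRel_adj, msggRel]
    adj_iff := fun h h' => by
      rw [gridVertex_eq h, gridVertex_eq h']
      simp only [msgg, SimpleGraph.fromRel_adj, msggRel, ne_eq, MSGGVertex.grid.injEq]
      omega }

theorem mem_horizontalLine {n j : ℕ} (hn : 2 ≤ n) {v : MSGGVertex n} :
    v ∈ horizontalLine n j ↔ v = .c₁ ∨ ∃ i, InGrid n i j ∧ v = gridVertex n i j := by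
  unfold horizontalLine
  rw [List.mem_cons, List.mem_filterMap]
  refine or_congr_right (exists_congr fun i => ?_)
  rw [List.mem_range'_1]
  by_cases h : InGrid n i j
  · rw [dif_pos h, Option.some_inj, gridVertex_eq h, eq_comm (a := v)]
    refine and_congr_left fun _ => iff_of_true ?_ h
    unfold InGrid at h
    omega
  · simp [h]

theorem mem_verticalLine {n i : ℕ} (hn : 2 ≤ n) {v : MSGGVertex n} :
    v ∈ verticalLine n i ↔ v = .c₂ ∨ ∃ j, InGrid n i j ∧ v = gridVertex n i j := by
  unfold verticalLine
  rw [List.mem_cons, List.mem_filterMap]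
  refine or_congr_right (exists_congr fun j => ?_)
  rw [List.mem_range'_1]
  by_cases h : InGrid n i j
  · rw [dif_pos h, Option.some_inj, gridVertex_eq h, eq_comm (a := v)]
    refine and_congr_left fun _ => iff_of_true ?_ h
    unfold InGrid at h
    omega
  · simp [h]

/-- A sequence that lists a first row, in order, is a line. -/
theorem IsSlantedGrid.isLineSequence_row {V : Type*} [Finite V] {G : SimpleGraph V}
    {S : ℕ → ℕ → Prop} {c₁ c₂ : V} {g : ℕ → ℕ → V} (h : IsSlantedGrid G S c₁ c₂ g)
    {f : V → Plane} (hf : IsVisibility G f) {j : ℕ} (hj : S 1 j) {l : List V}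
    (hmem : ∀ v, v ∈ c₁ :: l ↔ v = c₁ ∨ ∃ i, S i j ∧ v = g i j)
    (hl : l.Pairwise fun u v => ∃ i k, S k j ∧ 1 ≤ i ∧ i < k ∧ u = g i j ∧ v = g k j)
    (hc : c₁ ∉ l) : IsLineSequence f (c₁ :: l) := by
  refine isLineSequence_of_behind (x := g 1 j) ?_ (hf.inj.ne (h.ne₁ hj)) ?_ ?_ ?_
  · exact List.mem_of_ne_of_mem (h.ne₁ hj) ((hmem _).2 (Or.inr ⟨1, hj, rfl⟩))
  · intro v hv
    rcases (hmem v).1 (List.mem_cons_of_mem _ hv) with rfl | ⟨i, hi, rfl⟩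
    · exact (hc hv).elim
    · rcases (h.pos hi).1.eq_or_lt with rfl | h1
      · exact Or.inl rfl
      · exact Or.inr (h.row hf le_rfl hi h1)
  · refine hl.imp ?_
    rintro u v ⟨i, k, hk, h1, hik, rfl, rfl⟩
    exact h.row hf h1 hk hik
  · intro v s hv
    exact (hmem v).2 (h.row_only hf hj hv)

theorem isLineSequence_horizontalLine {n : ℕ} (hn : 2 ≤ n) {f : MSGGVertex n → Plane}
    (hf : IsVisibility (msgg n) f) {j : ℕ} (hj : InGrid n 1 j) :
    IsLineSequence f (horizontalLine n j) := by
  refine (isSlantedGrid_msgg hn).isLineSequence_row hf hj (fun v => mem_horizontalLine hn) ?_ ?_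
  · rw [List.pairwise_filterMap]
    refine (List.pairwise_lt_range' (s := 1) (n := n + 2 * n ^ 4)).imp ?_
    intro i k hik u hu v hv
    by_cases h1 : InGrid n i j
    · by_cases h2 : InGrid n k j
      · rw [dif_pos h1, Option.some_inj] at hu
        rw [dif_pos h2, Option.some_inj] at hv
        exact ⟨i, k, h2, ((isSlantedGrid_msgg hn).pos h1).1, hik,
          by rw [gridVertex_eq h1, hu], by rw [gridVertex_eq h2, hv]⟩
      · simp [h2] at hv
    · simp [h1] at hu
  · rw [List.mem_filterMap]
    rintro ⟨i, -, hi⟩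
    by_cases h1 : InGrid n i j <;> simp [h1] at hi

theorem isLineSequence_verticalLine {n : ℕ} (hn : 2 ≤ n) {f : MSGGVertex n → Plane}
    (hf : IsVisibility (msgg n) f) {i : ℕ} (hi : InGrid n i 1) :
    IsLineSequence f (verticalLine n i) := by
  refine (isSlantedGrid_msgg hn).swap.isLineSequence_row hf hi (fun v => mem_verticalLine hn) ?_ ?_
  · rw [List.pairwise_filterMap]
    refine (List.pairwise_lt_range' (s := 1) (n := n + 25 * n ^ 8)).imp ?_
    intro j k hjk u hu v hv
    by_cases h1 : InGrid n i j
    · by_cases h2 : InGrid n i k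
      · rw [dif_pos h1, Option.some_inj] at hu
        rw [dif_pos h2, Option.some_inj] at hv
        exact ⟨j, k, h2, ((isSlantedGrid_msgg hn).pos h1).2, hjk,
          by rw [gridVertex_eq h1, hu], by rw [gridVertex_eq h2, hv]⟩
      · simp [h2] at hv
    · simp [h1] at hu
  · rw [List.mem_filterMap]
    rintro ⟨j, -, hj⟩
    by_cases h1 : InGrid n i j <;> simp [h1] at hj

/-- Two vertices that do not see each other lie on a common horizontal or vertical line. -/
theorem IsSlantedGrid.exists_row_or_column {V : Type*} {G : SimpleGraph V} {S : ℕ → ℕ → Prop}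
    {c₁ c₂ : V} {g : ℕ → ℕ → V} (h : IsSlantedGrid G S c₁ c₂ g) {R C : ℕ → List V}
    (hR : ∀ j v, v ∈ R j ↔ v = c₁ ∨ ∃ i, S i j ∧ v = g i j)
    (hC : ∀ i v, v ∈ C i ↔ v = c₂ ∨ ∃ j, S i j ∧ v = g i j) {u v : V} (huv : u ≠ v)
    (ha : ¬ G.Adj u v) :
    ∃ M, ((∃ j, S 1 j ∧ M = R j) ∨ ∃ i, S i 1 ∧ M = C i) ∧ u ∈ M ∧ v ∈ M := by
  have key1 : ∀ {i j}, S i j → ∃ M, ((∃ j, S 1 j ∧ M = R j) ∨ ∃ i, S i 1 ∧ M = C i) ∧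
      c₁ ∈ M ∧ g i j ∈ M := fun {i j} hs =>
    ⟨R j, Or.inl ⟨j, h.first hs, rfl⟩, (hR _ _).2 (Or.inl rfl), (hR _ _).2 (Or.inr ⟨i, hs, rfl⟩)⟩
  have key2 : ∀ {i j}, S i j → ∃ M, ((∃ j, S 1 j ∧ M = R j) ∨ ∃ i, S i 1 ∧ M = C i) ∧
      c₂ ∈ M ∧ g i j ∈ M := fun {i j} hs =>
    ⟨C i, Or.inr ⟨i, h.swap.first hs, rfl⟩, (hC _ _).2 (Or.inl rfl),
      (hC _ _).2 (Or.inr ⟨j, hs, rfl⟩)⟩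
  rcases h.cases u with rfl | rfl | ⟨i, j, hs, rfl⟩
  · rcases h.cases v with rfl | rfl | ⟨k, l, hs', rfl⟩
    · exact (huv rfl).elim
    · exact (ha h.adj).elim
    · exact key1 hs'
  · rcases h.cases v with rfl | rfl | ⟨k, l, hs', rfl⟩
    · exact (ha h.adj.symm).elim
    · exact (huv rfl).elim
    · exact key2 hs'
  · rcases h.cases v with rfl | rfl | ⟨k, l, hs', rfl⟩
    · obtain ⟨M, hM, h1, h2⟩ := key1 hs
      exact ⟨M, hM, h2, h1⟩
    · obtain ⟨M, hM, h1, h2⟩ := key2 hs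
      exact ⟨M, hM, h2, h1⟩
    · rw [h.adj_iff hs hs'] at ha
      by_cases hjl : j = l
      · subst hjl
        exact ⟨R j, Or.inl ⟨j, h.first hs, rfl⟩, (hR _ _).2 (Or.inr ⟨i, hs, rfl⟩),
          (hR _ _).2 (Or.inr ⟨k, hs', rfl⟩)⟩
      · obtain rfl : i = k := by
          by_contra hik
          exact ha (Or.inl ⟨hik, hjl⟩)
        exact ⟨C i, Or.inr ⟨i, h.swap.first hs, rfl⟩, (hC _ _).2 (Or.inr ⟨j, hs, rfl⟩),
          (hC _ _).2 (Or.inr ⟨l, hs', rfl⟩)⟩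

theorem exists_isVisibility {n : ℕ} (hn : 2 ≤ n) :
    ∃ f : MSGGVertex n → Plane, IsVisibility (msgg n) f := by
  let x : MSGGVertex n → ℝ
    | .c₁ => 1
    | .c₂ => 0
    | .grid i _ _ => (i : ℝ)⁻¹
  let y : MSGGVertex n → ℝ
    | .c₁ => 0
    | .c₂ => 1
    | .grid _ j _ => ((j : ℝ) + √2)⁻¹
  let z : MSGGVertex n → ℝ
    | .c₁ => 0
    | .c₂ => 0
    | .grid _ _ _ => 1
  exact ⟨_, (isSlantedGrid_msgg hn).isVisibility_chartPoint (Real.sqrt_nonneg 2)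
    irrational_sqrt_two (x := x) (y := y) (z := z) rfl rfl rfl rfl rfl rfl
    (fun h => by rw [gridVertex_eq h]) (fun h => by rw [gridVertex_eq h])
    (fun h => by rw [gridVertex_eq h])⟩

theorem mainTheorem3 (n : ℕ) (hn : 2 ≤ n) :
    (∃ f : MSGGVertex n → Plane, IsVisibilityEmbedding (msgg n) f) ∧
    (∀ f f' : MSGGVertex n → Plane,
      IsVisibilityEmbedding (msgg n) f → IsVisibilityEmbedding (msgg n) f' →
        ∀ L : List (MSGGVertex n), IsLineSequence f L → IsPreservedIn L f') ∧
    (∀ f : MSGGVertex n → Plane, IsVisibilityEmbedding (msgg n) f →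
      (∀ L ∈ longLines n, IsLineSequence f L) ∧
      (∀ j : ℕ, 1 ≤ j → j ≤ n + 25 * n ^ 8 → IsLineSequence f (horizontalLine n j)) ∧
      (∀ i : ℕ, 1 ≤ i → i ≤ n + 2 * n ^ 4 → IsLineSequence f (verticalLine n i))) := by
  simp only [isVisibilityEmbedding_iff]
  have hG := isSlantedGrid_msgg hn
  have ha : 16 ≤ n ^ 4 := le_trans (by norm_num) (Nat.pow_le_pow_left hn 4)
  have hb : 16 ≤ n ^ 8 := le_trans (by norm_num) (Nat.pow_le_pow_left hn 8)
  have hg := gapWidth_le n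
  refine ⟨exists_isVisibility hn, ?_, ?_⟩
  · intro f f' hf hf' L hL
    have hlines : ∀ {k : MSGGVertex n → Plane}, IsVisibility (msgg n) k → ∀ M,
        ((∃ j, InGrid n 1 j ∧ M = horizontalLine n j) ∨
          ∃ i, InGrid n i 1 ∧ M = verticalLine n i) → IsLineSequence k M := by
      rintro k hk M (⟨j, hj, rfl⟩ | ⟨i, hi, rfl⟩)
      · exact isLineSequence_horizontalLine hn hk hj
      · exact isLineSequence_verticalLine hn hk hi
    exact isPreservedIn_of_family hf hf' (hlines hf) (hlines hf')
      (fun u v => hG.exists_row_or_column (fun _ _ => mem_horizontalLine hn)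
        (fun _ _ => mem_verticalLine hn)) hL
  · intro f hf
    have hH : ∀ j : ℕ, 1 ≤ j → j ≤ n + 25 * n ^ 8 → IsLineSequence f (horizontalLine n j) := by
      intro j h1 h2
      refine isLineSequence_horizontalLine hn hf ?_
      unfold InGrid
      omega
    have hV : ∀ i : ℕ, 1 ≤ i → i ≤ n + 2 * n ^ 4 → IsLineSequence f (verticalLine n i) := by
      intro i h1 h2
      refine isLineSequence_verticalLine hn hf ?_
      unfold InGrid
      omega
    refine ⟨?_, hH, hV⟩
    simp only [longLines, List.forall_mem_cons, List.not_mem_nil, false_imp_iff, implies_true,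
      and_true]
    exact ⟨hV 1 (by omega) (by omega), hV 2 (by omega) (by omega), hH 1 (by omega) (by omega),
      hH 2 (by omega) (by omega)⟩
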